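/- Let $k$ be a field of characteristic $0$. Let $\Theta$ be the variety of all alternative $k$-algebras, that is, of all (not necessarily unital or associative) $k$-algebras satisfying the identities $(aa)b=a(ab)$ and $b(aa)=(ba)a$. Let $\Theta^0$ be the category whose objects are the free algebras $F(X)$ of $\Theta$ generated by finite subsets $X$ of a fixed countably infinite alphabet $\{x_1,x_2,\dots\}$, and whose morphisms are all $k$-algebra homomorphisms between them. Let $\mathfrak A$ be the group of all automorphisms of the category $\Theta^0$ and $\mathfrak Y\trianglelefteq\mathfrak A$ the subgroup of inner automorphisms, i.e. of those isomorphic as functors to the identity functor. Let $\mathrm{Aut}\,k$ be the group of all automorphisms of the field $k$. Then $$\mathfrak A/\mathfrak Y\;\cong\;\mathbf S_2\times\mathrm{Aut}\,k .$$ More precisely, call an automorphism $\Phi$ of $\Theta^0$ strongly stable if it fixes all objects and there are bijections $s_F:F\to F$, one for each object $F=F(X)$, with $s_F|_X=\mathrm{id}_X$ and $\Phi(\psi)=s_F\,\psi\,s_D^{-1}$ for every morphism $\psi:D\to F$. Such a $\Phi$ corresponds to the system of words $W=\{w_0,w_\lambda\ (\lambda\in k),w_+,w_\cdot\}$ given by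 $w_0=s_{F(\varnothing)}(0)$, $w_\lambda=s_{F(x_1)}(\lambda x_1)$, $w_+=s_{F(x_1,x_2)}(x_1+x_2)$, $w_\cdot=s_{F(x_1,x_2)}(x_1x_2)$. For an arbitrary system of words $W$ with $w_0\in F(\varnothing)$, $w_\lambda\in F(x_1)$, $w_+,w_\cdot\in F(x_1,x_2)$ and an object $F$, let $F_W^*$ be the set $F$ with the operations defined by these words; call $W$ admissible if for every object $F=F(X)$ there is an isomorphism $F\to F_W^*$ which is the identity on $X$. For $\varepsilon\in\mathbf S_2$, $\varphi\in\mathrm{Aut}\,k$ and $\alpha\in k\setminus\{0\}$ let $W_{\varepsilon,\varphi,\alpha}$ be the system $$w_0=0,\qquad w_\lambda=\varphi(\lambda)x_1\ (\lambda\in k),\qquad w_+=x_1+x_2,\qquad w_\cdot=\alpha\,x_{\varepsilon(1)}x_{\varepsilon(2)},$$ so that $w_\cdot$ is $\alpha x_1x_2$ or $\alpha x_2x_1$. Then: 1. A system of words is admissible if and only if it is one of the systems $W_{\varepsilon,\varphi,\alpha}$. 2. Every strongly stable automorphism of $\Theta^0$ corresponds to some $W_{\varepsilon,\varphi,\alpha}$,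 and for all $\varepsilon\in\mathbf S_2$, $\varphi\in\mathrm{Aut}\,k$, $\alpha\in k\setminus\{0\}$ there is a strongly stable automorphism of $\Theta^0$ which corresponds to $W_{\varepsilon,\varphi,\alpha}$. 3. There is a group isomorphism $\mathfrak A/\mathfrak Y\to\mathbf S_2\times\mathrm{Aut}\,k$ which maps the coset $\Phi\mathfrak Y$ of every strongly stable automorphism $\Phi$ corresponding to a system $W_{\varepsilon,\varphi,\alpha}$ to $(\varepsilon,\varphi)$. -/

import Mathlib

open CategoryTheory

universe u v w

noncomputable section

/-! ### Alternative algebras and free alternative algebras -/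

/-- A (not necessarily unital or associative) linear algebra is alternative if it satisfies the
identities `(aa)b = a(ab)` and `b(aa) = (ba)a`. -/
class IsAlternativeAlgebra (A : Type*) [NonUnitalNonAssocRing A] : Prop where
  left_alternative : ∀ a b : A, (a * a) * b = a * (a * b)
  right_alternative : ∀ a b : A, b * (a * a) = (b * a) * a

section Free

variable (k : Type u) [Field k] (X : Type v)

/-- A subspace of the free nonassociative algebra which is a two-sided ideal and contains all values
of the alternative identities. -/
structure IsAltIdeal (I : Submodule k (FreeNonUnitalNonAssocAlgebra k X)) : Prop where
  mul_left_mem : ∀ a b, b ∈ I → a * b ∈ I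
  mul_right_mem : ∀ a b, a ∈ I → a * b ∈ I
  left_alternative_mem : ∀ a b, (a * a) * b - a * (a * b) ∈ I
  right_alternative_mem : ∀ a b, b * (a * a) - (b * a) * a ∈ I

/-- The smallest two-sided ideal containing all values of the alternative identities. -/
def altIdeal : Submodule k (FreeNonUnitalNonAssocAlgebra k X) :=
  sInf {I | IsAltIdeal k X I}

variable {k X} in
theorem mem_altIdeal {a : FreeNonUnitalNonAssocAlgebra k X} :
    a ∈ altIdeal k X ↔ ∀ I, IsAltIdeal k X I → a ∈ I := by
  simp [altIdeal, Submodule.mem_sInf]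

theorem isAltIdeal_altIdeal : IsAltIdeal k X (altIdeal k X) where
  mul_left_mem a b hb :=
    mem_altIdeal.2 fun I hI => hI.mul_left_mem a b (mem_altIdeal.1 hb I hI)
  mul_right_mem a b ha :=
    mem_altIdeal.2 fun I hI => hI.mul_right_mem a b (mem_altIdeal.1 ha I hI)
  left_alternative_mem a b := mem_altIdeal.2 fun _ hI => hI.left_alternative_mem a b
  right_alternative_mem a b := mem_altIdeal.2 fun _ hI => hI.right_alternative_mem a b

/-- The free alternative `k`-algebra (without unit) on the set of generators `X`. -/
def FreeAlt : Type (max u v) := FreeNonUnitalNonAssocAlgebra k X ⧸ altIdeal k X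

namespace FreeAlt

instance instAddCommGroup : AddCommGroup (FreeAlt k X) :=
  inferInstanceAs (AddCommGroup (FreeNonUnitalNonAssocAlgebra k X ⧸ altIdeal k X))

instance instModule : Module k (FreeAlt k X) :=
  inferInstanceAs (Module k (FreeNonUnitalNonAssocAlgebra k X ⧸ altIdeal k X))

/-- The canonical projection from the free nonassociative algebra. -/
def mk : FreeNonUnitalNonAssocAlgebra k X →ₗ[k] FreeAlt k X := (altIdeal k X).mkQ

theorem mk_surjective : Function.Surjective (mk k X) := (altIdeal k X).mkQ_surjective

variable {k X} in
theorem mk_eq_mk {a b : FreeNonUnitalNonAssocAlgebra k X} :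
    mk k X a = mk k X b ↔ a - b ∈ altIdeal k X :=
  Submodule.Quotient.eq _

theorem mk_mul_congr (a a' b b' : FreeNonUnitalNonAssocAlgebra k X)
    (ha : mk k X a = mk k X a') (hb : mk k X b = mk k X b') :
    mk k X (a * b) = mk k X (a' * b') := by
  rw [mk_eq_mk] at ha hb ⊢
  have h : a * b - a' * b' = (a - a') * b + a' * (b - b') := by
    rw [sub_mul, mul_sub]; abel
  rw [h]
  exact add_mem ((isAltIdeal_altIdeal k X).mul_right_mem _ _ ha)
    ((isAltIdeal_altIdeal k X).mul_left_mem _ _ hb)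

instance instMul : Mul (FreeAlt k X) where
  mul := Quotient.map₂ (· * ·) fun a a' ha b b' hb => by
    have h := mk_mul_congr k X a a' b b' (Quotient.sound ha) (Quotient.sound hb)
    exact Quotient.exact h

theorem mk_mul (a b : FreeNonUnitalNonAssocAlgebra k X) :
    mk k X (a * b) = mk k X a * mk k X b := rfl

instance instNonUnitalNonAssocRing : NonUnitalNonAssocRing (FreeAlt k X) :=
  { instAddCommGroup k X, instMul k X with
    left_distrib := fun a b c => by
      obtain ⟨a, rfl⟩ := mk_surjective k X a
      obtain ⟨b, rfl⟩ := mk_surjective k X b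
      obtain ⟨c, rfl⟩ := mk_surjective k X c
      rw [← map_add, ← mk_mul, ← mk_mul, ← mk_mul, ← map_add, mul_add]
    right_distrib := fun a b c => by
      obtain ⟨a, rfl⟩ := mk_surjective k X a
      obtain ⟨b, rfl⟩ := mk_surjective k X b
      obtain ⟨c, rfl⟩ := mk_surjective k X c
      rw [← map_add, ← mk_mul, ← mk_mul, ← mk_mul, ← map_add, add_mul]
    zero_mul := fun a => by
      obtain ⟨a, rfl⟩ := mk_surjective k X a
      rw [← map_zero (mk k X), ← mk_mul, zero_mul]
    mul_zero := fun a => by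
      obtain ⟨a, rfl⟩ := mk_surjective k X a
      rw [← map_zero (mk k X), ← mk_mul, mul_zero] }

instance instIsScalarTower : IsScalarTower k (FreeAlt k X) (FreeAlt k X) where
  smul_assoc c a b := by
    obtain ⟨a, rfl⟩ := mk_surjective k X a
    obtain ⟨b, rfl⟩ := mk_surjective k X b
    simp only [smul_eq_mul]
    rw [← map_smul, ← mk_mul, ← mk_mul, ← map_smul, smul_mul_assoc]

instance instSMulCommClass : SMulCommClass k (FreeAlt k X) (FreeAlt k X) where
  smul_comm c a b := by
    obtain ⟨a, rfl⟩ := mk_surjective k X a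
    obtain ⟨b, rfl⟩ := mk_surjective k X b
    simp only [smul_eq_mul]
    rw [← map_smul, ← mk_mul, ← mk_mul, ← map_smul, mul_smul_comm]

instance instIsAlternativeAlgebra : IsAlternativeAlgebra (FreeAlt k X) where
  left_alternative a b := by
    obtain ⟨a, rfl⟩ := mk_surjective k X a
    obtain ⟨b, rfl⟩ := mk_surjective k X b
    simp only [← mk_mul]
    exact mk_eq_mk.2 ((isAltIdeal_altIdeal k X).left_alternative_mem a b)
  right_alternative a b := by
    obtain ⟨a, rfl⟩ := mk_surjective k X a
    obtain ⟨b, rfl⟩ := mk_surjective k X b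
    simp only [← mk_mul]
    exact mk_eq_mk.2 ((isAltIdeal_altIdeal k X).right_alternative_mem a b)

variable {X} in
/-- The free generators. -/
def of (x : X) : FreeAlt k X := mk k X (FreeNonUnitalNonAssocAlgebra.of k x)

section Lift

variable {k X} {A : Type w} [NonUnitalNonAssocRing A] [Module k A] [IsScalarTower k A A]
  [SMulCommClass k A A]

theorem lift_aux [IsAlternativeAlgebra A] (f : X → A) (a : FreeNonUnitalNonAssocAlgebra k X)
    (ha : a ∈ altIdeal k X) : FreeNonUnitalNonAssocAlgebra.lift k f a = 0 := by
  let g := FreeNonUnitalNonAssocAlgebra.lift k f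
  have hI : IsAltIdeal k X (LinearMap.ker (g : FreeNonUnitalNonAssocAlgebra k X →ₗ[k] A)) := by
    refine ⟨fun a b hb => ?_, fun a b ha => ?_, fun a b => ?_, fun a b => ?_⟩
    · have hb' : g b = 0 := hb
      change g (a * b) = 0
      rw [map_mul, hb', mul_zero]
    · have ha' : g a = 0 := ha
      change g (a * b) = 0
      rw [map_mul, ha', zero_mul]
    · change g ((a * a) * b - a * (a * b)) = 0
      rw [map_sub, map_mul, map_mul, map_mul, map_mul,
        IsAlternativeAlgebra.left_alternative, sub_self]
    · change g (b * (a * a) - (b * a) * a) = 0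
      rw [map_sub, map_mul, map_mul, map_mul, map_mul,
        IsAlternativeAlgebra.right_alternative, sub_self]
  exact mem_altIdeal.1 ha _ hI

/-- The homomorphism from the free alternative algebra to an alternative algebra `A` which extends a
map from the generators to `A`. -/
def lift [IsAlternativeAlgebra A] (f : X → A) : FreeAlt k X →ₙₐ[k] A :=
  { (altIdeal k X).liftQ
      ((FreeNonUnitalNonAssocAlgebra.lift k f : FreeNonUnitalNonAssocAlgebra k X →ₙₐ[k] A) :
        FreeNonUnitalNonAssocAlgebra k X →ₗ[k] A) (fun a ha => lift_aux f a ha) with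
    map_zero' := map_zero _
    map_mul' := fun a b => by
      obtain ⟨a, rfl⟩ := mk_surjective k X a
      obtain ⟨b, rfl⟩ := mk_surjective k X b
      exact map_mul (FreeNonUnitalNonAssocAlgebra.lift k f) a b }

@[simp]
theorem lift_of [IsAlternativeAlgebra A] (f : X → A) (x : X) : lift f (of k x) = f x :=
  FreeNonUnitalNonAssocAlgebra.lift_of_apply k f x

theorem hom_ext {g h : FreeAlt k X →ₙₐ[k] A} (H : ∀ x, g (of k x) = h (of k x)) : g = h := by
  let p : FreeNonUnitalNonAssocAlgebra k X →ₙₐ[k] FreeAlt k X :=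
    { mk k X with
      map_zero' := (mk k X).map_zero
      map_mul' := mk_mul k X }
  have hp : g.comp p = h.comp p := FreeNonUnitalNonAssocAlgebra.hom_ext k H
  ext a
  obtain ⟨a, rfl⟩ := mk_surjective k X a
  exact DFunLike.congr_fun hp a

end Lift

end FreeAlt

end Free

/-! ### The category of finitely generated free algebras -/

/-- The objects of the category `Θ⁰`: for each finite subset `gens` of the countable alphabet
`x₁, x₂, …` (the letter `x_{i+1}` being represented by `i : ℕ`), the free alternative algebra
generated by this subset. -/
structure AltCat (k : Type u) : Type where
  /-- the finite set of free generators -/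
  gens : Finset ℕ

namespace AltCat

variable {k : Type u} [Field k]

/-- The free algebra `F(X)`. -/
abbrev F (A : AltCat k) : Type u := FreeAlt k A.gens

/-- The element `x ∈ F(X)` for `x ∈ X`. -/
abbrev gen (A : AltCat k) (x : A.gens) : A.F := FreeAlt.of k x

/-- The morphisms of `Θ⁰` are all homomorphisms of `k`-algebras. -/
instance : Category (AltCat k) where
  Hom A B := A.F →ₙₐ[k] B.F
  id A := NonUnitalAlgHom.id k A.F
  comp f g := g.comp f

/-- A morphism of `Θ⁰` as a homomorphism of algebras. -/
abbrev toHom {A B : AltCat k} (f : A ⟶ B) : A.F →ₙₐ[k] B.F := f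

end AltCat

/-! ### Automorphisms of a category -/

/-- The group of all automorphisms of a category, i.e. of functors with a strict inverse, under
composition: `(Φ * Ψ)(f) = Φ(Ψ(f))`. -/
abbrev CatAut (C : Type v) [Category.{u} C] : Type (max u v) := Aut (Cat.of C)

/-- The functor underlying an automorphism of a category. -/
abbrev CatAut.functor {C : Type v} [Category.{u} C] (Φ : CatAut C) : C ⥤ C :=
  (Iso.hom (Φ : Cat.of C ≅ Cat.of C)).toFunctor

/-- The subgroup of inner automorphisms: those isomorphic, as functors, to the identity. -/
def innerAut (C : Type v) [Category.{u} C] : Subgroup (CatAut C) where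
  carrier := {Φ | Nonempty (𝟭 C ≅ Φ.functor)}
  one_mem' := ⟨Iso.refl _⟩
  mul_mem' := by
    rintro Φ Ψ ⟨i⟩ ⟨j⟩
    exact ⟨j ≪≫ Functor.isoWhiskerLeft Ψ.functor i⟩
  inv_mem' := by
    rintro Φ ⟨i⟩
    have h : Φ⁻¹.functor ⋙ Φ.functor = 𝟭 C :=
      congrArg Cat.Hom.toFunctor (Iso.inv_hom_id (Φ : Cat.of C ≅ Cat.of C))
    exact ⟨(Functor.isoWhiskerLeft Φ⁻¹.functor i ≪≫ eqToIso h).symm⟩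

instance innerAut_normal (C : Type v) [Category.{u} C] : (innerAut C).Normal where
  conj_mem := by
    rintro Φ ⟨i⟩ Ψ
    have h : Ψ⁻¹.functor ⋙ Ψ.functor = 𝟭 C :=
      congrArg Cat.Hom.toFunctor (Iso.inv_hom_id (Ψ : Cat.of C ≅ Cat.of C))
    exact ⟨eqToIso h.symm ≪≫
      Functor.isoWhiskerLeft Ψ⁻¹.functor (Functor.isoWhiskerRight i Ψ.functor)⟩

/-! ### Strongly stable automorphisms and systems of words -/

namespace AltCat

variable {k : Type u} [Field k]

/-- `Φ` is a strongly stable automorphism of `Θ⁰` with the system of bijections `s`: `Φ` fixes all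
objects, acts on morphisms by `Φ(ψ) = s_E ψ s_D⁻¹`, and all `s_E` fix the free generators. The
morphisms `eqToHom` are the identities `D = Φ(D)` and `Φ(E) = E`. -/
structure IsStronglyStableBy (Φ : CatAut (AltCat k)) (s : ∀ A : AltCat k, A.F ≃ A.F) : Prop where
  obj_eq : ∀ A, Φ.functor.obj A = A
  map_eq : ∀ {D E : AltCat k} (ψ : D ⟶ E) (a : D.F),
    toHom (eqToHom (obj_eq D).symm ≫ Φ.functor.map ψ ≫ eqToHom (obj_eq E)) a =
      s E (toHom ψ ((s D).symm a))
  gen_eq : ∀ (A : AltCat k) (x : A.gens), s A (A.gen x) = A.gen x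

/-- Strongly stable automorphisms of `Θ⁰`. -/
def IsStronglyStable (Φ : CatAut (AltCat k)) : Prop :=
  ∃ s : ∀ A : AltCat k, A.F ≃ A.F, IsStronglyStableBy Φ s

variable (k) in
/-- The object `F(x₁, …, xₘ)` of `Θ⁰`. -/
abbrev fin (m : ℕ) : AltCat k := ⟨Finset.range m⟩

variable (k) in
/-- The generators `x₁, …, xₘ` of `F(x₁, …, xₘ)`, numbered by `0, …, m - 1`. -/
def var {m : ℕ} (i : Fin m) : (fin k m).F := (fin k m).gen ⟨i, Finset.mem_range.2 i.2⟩

/-- The value `w(h₁, …, hₘ)` of the word `w ∈ F(x₁, …, xₘ)` in an alternative algebra. -/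
def eval {m : ℕ} {H : Type w} [NonUnitalNonAssocRing H] [Module k H] [IsScalarTower k H H]
    [SMulCommClass k H H] [IsAlternativeAlgebra H] (w : (fin k m).F) (h : Fin m → H) : H :=
  FreeAlt.lift (fun x : Finset.range m => h ⟨x, Finset.mem_range.1 x.2⟩) w

end AltCat

open AltCat in
/-- A system of words, one for each basic operation of linear algebras over `k`: the constant `0`,
the unary multiplications by the scalars `c ∈ k`, the addition and the multiplication. -/
@[ext]
structure WordSystem (k : Type u) [Field k] where
  /-- the word for the constant `0` -/
  zero : (fin k 0).F
  /-- the words for the multiplications by scalars -/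
  smul : k → (fin k 1).F
  /-- the word for the addition -/
  add : (fin k 2).F
  /-- the word for the multiplication -/
  mul : (fin k 2).F

namespace WordSystem

open AltCat

variable {k : Type u} [Field k]

/-- `σ` is an isomorphism from `F = F(X)` to `F_W^*`, the set `F` with the verbal operations defined
by the words of `W`, and `σ` fixes `X`. -/
structure IsVerbalIso (W : WordSystem k) (A : AltCat k) (σ : A.F ≃ A.F) : Prop where
  map_zero : σ 0 = eval W.zero ![]
  map_smul : ∀ (c : k) (a : A.F), σ (c • a) = eval (W.smul c) ![σ a]
  map_add : ∀ a b : A.F, σ (a + b) = eval W.add ![σ a, σ b]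
  map_mul : ∀ a b : A.F, σ (a * b) = eval W.mul ![σ a, σ b]
  map_gen : ∀ x : A.gens, σ (A.gen x) = A.gen x

/-- `W` satisfies the conditions under which it defines a strongly stable automorphism: for every
object `F = F(X)` of `Θ⁰` there is an isomorphism `F → F_W^*` fixing `X`. -/
def IsAdmissible (W : WordSystem k) : Prop :=
  ∀ A : AltCat k, ∃ σ : A.F ≃ A.F, W.IsVerbalIso A σ

/-- The automorphism `Φ` is strongly stable and corresponds to the system of words `W`: with `s` the
system of bijections of `Φ`, the word of an operation `ω` of arity `m` is `s(ω(x₁, …, xₘ))`. -/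
def Corresponds (Φ : CatAut (AltCat k)) (W : WordSystem k) : Prop :=
  ∃ s : ∀ A : AltCat k, A.F ≃ A.F, IsStronglyStableBy Φ s ∧
    W.zero = s (fin k 0) 0 ∧
    (∀ c : k, W.smul c = s (fin k 1) (c • var k 0)) ∧
    W.add = s (fin k 2) (var k 0 + var k 1) ∧
    W.mul = s (fin k 2) (var k 0 * var k 1)

/-- The system of words `w_0 = 0`, `w_c = φ(c) x₁`, `w_+ = x₁ + x₂`, and `w_· = α x₁ x₂` if `ε` is
the identity, `w_· = α x₂ x₁` if `ε` is the transposition. -/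
def twisted (ε : Equiv.Perm (Fin 2)) (φ : RingAut k) (α : k) : WordSystem k where
  zero := 0
  smul c := φ c • var k 0
  add := var k 0 + var k 1
  mul := α • (var k (ε 0) * var k (ε 1))

end WordSystem

end

noncomputable section

/-! ### Generalities on alternative algebras -/

/-! An admissible system of words transports the linear algebra structure of each free algebra along
a bijection fixing the generators, so identities valid in the algebra constrain the words. In one
generator the left Moufang identity makes the powers multiply as usual, so the free algebra is the
ideal of polynomials without constant term and substitution is composition of polynomials. Since
multiplication by `c ≠ 0` is invertible, degrees force `w_c = f(c) x₁`
(`FreeAlt.eq_smul_of_lift_eq_of`). Compatibility with scalars then makes `w_+` homogeneous of degree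
one and `w_·` of degree one in each variable: `f` is injective and `k` infinite, so a polynomial
argument applies (`FreeAlt.mem_span_of_scale`). The laws of zero give `w_+ = x₁ + x₂`, while `w_· =
α x₁x₂ + β x₂x₁`, and the alternative law evaluated on matrices gives `αβ = 0`. Finally `f` is a
field automorphism. Conversely, twisting a free algebra by `ε`, `φ` and `α` yields an alternative
algebra, and freeness provides the required isomorphism. The bijections of a strongly stable
automorphism form such a transport (`WordSystem.isVerbalIso_ofBij`). Composition multiplies `ε` and
`φ`. A natural isomorphism from the identity differs from these bijections only by a scalar
(`AltCat.exists_smul_of_natural`), so the automorphism is inner exactly when `ε = 1` and `φ = 1`;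
the constant `α` is invisible modulo inner automorphisms. It remains to see that every automorphism
is strongly stable up to an inner one. A self-equivalence preserves the one-generated free algebra
up to isomorphism, by a retract argument. This object represents the underlying set functor, and
every object is a finite copower of it, so conjugation makes the automorphism fix objects and
generators (`AltCat.exists_isStronglyStable_iso`). -/

instance IsAlternativeAlgebra.of_nonUnitalRing (A : Type*) [NonUnitalRing A] :
    IsAlternativeAlgebra A where
  left_alternative a := mul_assoc a a
  right_alternative a b := (mul_assoc b a a).symm

/-- A vector space with zero multiplication. -/
def ZeroMulAlgebra (V : Type*) : Type _ := V

namespace ZeroMulAlgebra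

instance (V : Type*) [AddCommGroup V] : NonUnitalNonAssocRing (ZeroMulAlgebra V) :=
  { (inferInstanceAs (AddCommGroup V) : AddCommGroup (ZeroMulAlgebra V)) with
    mul := fun _ _ => (0 : V)
    left_distrib := fun _ _ _ => (add_zero (0 : V)).symm
    right_distrib := fun _ _ _ => (add_zero (0 : V)).symm
    zero_mul := fun _ => rfl
    mul_zero := fun _ => rfl }

variable {V : Type*} [AddCommGroup V]

theorem mul_eq_zero (a b : ZeroMulAlgebra V) : a * b = 0 := rfl

instance : IsAlternativeAlgebra (ZeroMulAlgebra V) where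
  left_alternative _ _ := rfl
  right_alternative _ _ := rfl

variable {k : Type*} [Field k] [Module k V]

instance : Module k (ZeroMulAlgebra V) := inferInstanceAs (Module k V)

instance : IsScalarTower k (ZeroMulAlgebra V) (ZeroMulAlgebra V) where
  smul_assoc c _ _ := (smul_zero (A := V) c).symm

instance : SMulCommClass k (ZeroMulAlgebra V) (ZeroMulAlgebra V) where
  smul_comm c _ _ := smul_zero (A := V) c

end ZeroMulAlgebra

namespace IsAlternativeAlgebra

variable {A : Type*} [NonUnitalNonAssocRing A] [IsAlternativeAlgebra A]

theorem left_linearized (a b c : A) : (a * b) * c + (b * a) * c = a * (b * c) + b * (a * c) := by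
  have h := left_alternative (a + b) c
  simp only [add_mul, mul_add, left_alternative] at h
  linear_combination (norm := abel) h

theorem right_linearized (a b c : A) : c * (a * b) + c * (b * a) = (c * a) * b + (c * b) * a := by
  have h := right_alternative (a + b) c
  simp only [add_mul, mul_add, right_alternative] at h
  linear_combination (norm := abel) h

theorem flexible (a b : A) : (a * b) * a = a * (b * a) := by
  have h := right_linearized a b a
  rw [left_alternative] at h
  have h' : a * (a * b) + a * (b * a) = a * (a * b) + (a * b) * a := by
    exact h
  exact (add_left_cancel h').symm

/-- The left Moufang identity. -/
theorem left_moufang (x y z : A) : (x * (y * x)) * z = x * (y * (x * z)) := by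
  -- `h1` and `h2` share the term `(xy)(xz)`, which cancels on subtraction; `h3` and `h4` are two
  -- expansions of `x(x(yz)) + x(x(zy))`, and their difference removes the other unwanted terms.
  have h1 := left_linearized (x * y) x z
  have h2 := right_linearized y (x * z) x
  have h3 := right_linearized y z (x * x)
  have h4 := congrArg (x * ·) (right_linearized y z x)
  simp only [mul_add] at h4
  rw [← left_alternative x y] at h1
  rw [← left_alternative x z] at h2
  rw [left_alternative x (y * z), left_alternative x (z * y)] at h3
  rw [← flexible]
  linear_combination (norm := abel) h1 - h2 + h3 - h4

end IsAlternativeAlgebra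

/-! ### The structure of free alternative algebras -/

namespace FreeAlt

variable {k : Type u} [Field k] {X : Type v}

variable (k) in
/-- The monomials in the free alternative algebra. -/
def mon : FreeMagma X →ₙ* FreeAlt k X := FreeMagma.lift (of k)

theorem mon_of (x : X) : mon k (FreeMagma.of x) = of k x := rfl

theorem mk_single (m : FreeMagma X) : mk k X (MonoidAlgebra.single m 1) = mon k m := by
  induction m with
  | ih1 x => rfl
  | ih2 x y hx hy =>
    rw [map_mul, ← hx, ← hy, ← mk_mul, MonoidAlgebra.single_mul_single, one_mul]

theorem span_mon : Submodule.span k (Set.range (mon k (X := X))) = ⊤ := by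
  rw [eq_top_iff]
  rintro a -
  obtain ⟨a, rfl⟩ := mk_surjective k X a
  induction a using MonoidAlgebra.induction_linear with
  | zero => rw [map_zero]; exact zero_mem _
  | add f g hf hg => rw [map_add]; exact add_mem hf hg
  | single m c =>
    have h : (MonoidAlgebra.single m c : FreeNonUnitalNonAssocAlgebra k X) =
        c • MonoidAlgebra.single m 1 := by
      rw [MonoidAlgebra.smul_single, smul_eq_mul, mul_one]
    rw [h, map_smul, mk_single]
    exact Submodule.smul_mem _ _ (Submodule.subset_span ⟨m, rfl⟩)

@[elab_as_elim]
theorem induction {P : FreeAlt k X → Prop} (of : ∀ x, P (FreeAlt.of k x))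
    (mul : ∀ a b, P a → P b → P (a * b)) (zero : P 0) (add : ∀ a b, P a → P b → P (a + b))
    (smul : ∀ (c : k) a, P a → P (c • a)) (a : FreeAlt k X) : P a := by
  have ha : a ∈ Submodule.span k (Set.range (mon k (X := X))) := by
    rw [span_mon]; trivial
  induction ha using Submodule.span_induction with
  | mem x h =>
    obtain ⟨m, rfl⟩ := h
    induction m with
    | ih1 x => exact of x
    | ih2 x y hx hy => rw [map_mul]; exact mul _ _ hx hy
  | zero => exact zero
  | add x y _ _ hx hy => exact add _ _ hx hy
  | smul c x _ hx => exact smul c x hx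

/-! ### Homogeneity detected by scaling the generators. -/

section Weight

variable (v : X → ℕ)

/-- The weight of a monomial for given weights of the letters. -/
def weight : FreeMagma X → ℕ
  | .of x => v x
  | .mul a b => weight a + weight b

theorem weight_of (x : X) : weight v (FreeMagma.of x) = v x := rfl

theorem weight_mul (a b : FreeMagma X) : weight v (a * b) = weight v a + weight v b := rfl

/-- The endomorphism multiplying each letter by a power of `c`, according to its weight. -/
def scale (c : k) : FreeAlt k X →ₙₐ[k] FreeAlt k X := lift fun x => c ^ v x • of k x

theorem scale_mon (c : k) (m : FreeMagma X) : scale v c (mon k m) = c ^ weight v m • mon k m := by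
  induction m with
  | ih1 x => exact lift_of _ x
  | ih2 x y hx hy =>
    rw [map_mul, map_mul, hx, hy, weight_mul, smul_mul_smul_comm, pow_add]

/-- Let `u` be the weight-one part of some expression of `w` in monomials. For each linear
functional `g`, the value `g(scale v c w)` is a polynomial in `c` with linear coefficient `g(u)`; it
equals `c g(w)` for infinitely many `c`, so `g(w) = g(u)`, and functionals separate points. No
grading of the quotient is needed. The set `T` allows several weights to be treated in succession.
-/
theorem mem_span_of_scale {T : Set (FreeMagma X)} {w : FreeAlt k X}
    (hw : w ∈ Submodule.span k (mon k '' T)) {S : Set k} (hS : S.Infinite)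
    (h : ∀ c ∈ S, scale v c w = c • w) :
    w ∈ Submodule.span k (mon k '' {m ∈ T | weight v m = 1}) := by
  have key : ∃ u ∈ Submodule.span k (mon k '' {m ∈ T | weight v m = 1}),
      ∀ g : Module.Dual k (FreeAlt k X), ∃ P : Polynomial k,
        (∀ c, P.eval c = g (scale v c w)) ∧ P.coeff 1 = g u := by
    clear h
    induction hw using Submodule.span_induction with
    | mem x hx =>
      obtain ⟨m, hm, rfl⟩ := hx
      by_cases h1 : weight v m = 1
      · refine ⟨mon k m, Submodule.subset_span ⟨m, ⟨hm, h1⟩, rfl⟩, fun g =>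
          ⟨.C (g (mon k m)) * .X, fun c => ?_, ?_⟩⟩
        · simp [scale_mon, h1, mul_comm c]
        · simp
      · refine ⟨0, zero_mem _, fun g =>
          ⟨.C (g (mon k m)) * .X ^ weight v m, fun c => ?_, ?_⟩⟩
        · simp [scale_mon, mul_comm (c ^ _)]
        · simp [Polynomial.coeff_X_pow, Ne.symm h1]
    | zero => exact ⟨0, zero_mem _, fun g => ⟨0, by simp, by simp⟩⟩
    | add x y _ _ hx hy =>
      obtain ⟨u, hu, hx⟩ := hx
      obtain ⟨u', hu', hy⟩ := hy
      refine ⟨u + u', add_mem hu hu', fun g => ?_⟩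
      obtain ⟨P, hP, hP'⟩ := hx g
      obtain ⟨Q, hQ, hQ'⟩ := hy g
      exact ⟨P + Q, by simp [hP, hQ], by simp [hP', hQ']⟩
    | smul a x _ hx =>
      obtain ⟨u, hu, hx⟩ := hx
      refine ⟨a • u, Submodule.smul_mem _ _ hu, fun g => ?_⟩
      obtain ⟨P, hP, hP'⟩ := hx g
      exact ⟨a • P, by simp [hP], by simp [hP']⟩
  obtain ⟨u, hu, hP⟩ := key
  suffices hwu : w - u = 0 by rwa [sub_eq_zero.1 hwu]
  refine (Module.forall_dual_apply_eq_zero_iff k _).1 fun g => ?_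
  obtain ⟨P, hP, hP'⟩ := hP g
  have h0 : P = .C (g w) * .X :=
    Polynomial.eq_of_infinite_eval_eq _ _ (hS.mono fun c hc => by
      simp [hP, h c hc, mul_comm c])
  rw [h0] at hP'
  rw [map_sub, ← hP']
  simp

end Weight

variable (k) in
/-- The homomorphism to a zero algebra which maps `x` to `1` and the other generators to `0`. -/
def coordHom (x : X) : FreeAlt k X →ₙₐ[k] ZeroMulAlgebra k :=
  lift fun y => open Classical in if y = x then (1 : k) else (0 : k)

variable (k) in
/-- The coefficient of the generator `x` in an element of the free algebra. -/
def coord (x : X) : FreeAlt k X →ₗ[k] k where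
  toFun := coordHom k x
  map_add' := map_add (coordHom k x)
  map_smul' := map_smul (coordHom k x)

theorem coord_of_self (x : X) : coord k x (of k x) = 1 :=
  (lift_of (A := ZeroMulAlgebra k) _ x).trans (if_pos rfl)

theorem coord_of_ne {x y : X} (h : y ≠ x) : coord k x (of k y) = 0 :=
  (lift_of (A := ZeroMulAlgebra k) _ y).trans (if_neg h)

theorem coord_mul (x : X) (a b : FreeAlt k X) : coord k x (a * b) = 0 :=
  (map_mul (coordHom k x) a b).trans (ZeroMulAlgebra.mul_eq_zero _ _)

theorem of_ne_zero (x : X) : of k x ≠ 0 := by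
  intro h
  have h1 := coord_of_self (k := k) x
  rw [h, map_zero] at h1
  exact zero_ne_one h1

theorem smul_of_injective (x : X) : Function.Injective fun c : k => c • of k x :=
  smul_left_injective k (of_ne_zero x)

end FreeAlt

/-! ### The free alternative algebra with one generator -/

namespace IsAlternativeAlgebra

variable {A : Type*} [NonUnitalNonAssocRing A]

/-- The power `a ^ (n + 1)`, as an iterated product. -/
def powSucc (a : A) : ℕ → A
  | 0 => a
  | n + 1 => a * powSucc a n

theorem powSucc_eq_iterate (a : A) (n : ℕ) : powSucc a n = (a * ·)^[n] a := by
  induction n with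
  | zero => rfl
  | succ n ih => rw [Function.iterate_succ_apply', ← ih, powSucc]

variable [IsAlternativeAlgebra A]

theorem powSucc_mul_self (a : A) (n : ℕ) : powSucc a n * a = a * powSucc a n := by
  induction n with
  | zero => rfl
  | succ n ih => rw [powSucc, flexible, ih]

/-- The left Moufang identity turns left multiplication by `a(bm)a`, for a power `bm` of `a`, into
the composite of the three left multiplications; the induction therefore advances by two. -/
theorem powSucc_mul (a z : A) (n : ℕ) : powSucc a n * z = (a * ·)^[n + 1] z := by
  induction n using Nat.twoStepInduction generalizing z with
  | zero => rfl
  | one => exact left_alternative a z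
  | more n ih _ =>
    rw [powSucc, powSucc, ← powSucc_mul_self, left_moufang, ih, ← Function.iterate_succ_apply,
      ← Function.iterate_succ_apply' (a * ·)]

theorem powSucc_mul_powSucc (a : A) (n m : ℕ) :
    powSucc a n * powSucc a m = powSucc a (n + m + 1) := by
  rw [powSucc_mul, powSucc_eq_iterate, powSucc_eq_iterate, ← Function.iterate_add_apply,
    Nat.add_right_comm]

end IsAlternativeAlgebra

namespace FreeAlt

open IsAlternativeAlgebra

variable {k : Type u} [Field k] {X : Type v}

/-- The homomorphism to the polynomial algebra mapping each generator to the variable. -/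
def toPoly : FreeAlt k X →ₙₐ[k] Polynomial k := lift fun _ => Polynomial.X

theorem toPoly_of (x : X) : toPoly (of k x) = Polynomial.X := lift_of _ x

theorem coeff_zero_toPoly (a : FreeAlt k X) : (toPoly a).coeff 0 = 0 := by
  induction a using FreeAlt.induction with
  | of x => simp [toPoly_of]
  | mul a b ha hb => simp [ha, Polynomial.mul_coeff_zero]
  | zero => simp
  | add a b ha hb => simp [ha, hb]
  | smul c a ha => simp [ha]

theorem toPoly_powSucc (x : X) (n : ℕ) : toPoly (powSucc (of k x) n) = Polynomial.X ^ (n + 1) := by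
  induction n with
  | zero => simp [powSucc, toPoly_of]
  | succ n ih => rw [powSucc, map_mul, ih, toPoly_of, ← pow_succ']

theorem toPoly_lift (u a : FreeAlt k X) :
    toPoly (lift (fun _ => u) a) = (toPoly a).comp (toPoly u) := by
  induction a using FreeAlt.induction with
  | of x => rw [lift_of, toPoly_of, Polynomial.X_comp]
  | mul a b ha hb => simp [ha, hb]
  | zero => simp
  | add a b ha hb => simp [ha, hb]
  | smul c a ha => simp [ha]

variable [Subsingleton X]

theorem mem_span_powSucc (x : X) (a : FreeAlt k X) :
    a ∈ Submodule.span k (Set.range (powSucc (of k x))) := by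
  induction a using FreeAlt.induction with
  | of y => exact Submodule.subset_span ⟨0, by rw [powSucc, Subsingleton.elim x y]⟩
  | mul a b ha hb =>
    induction ha using Submodule.span_induction with
    | mem a h =>
      obtain ⟨n, rfl⟩ := h
      induction hb using Submodule.span_induction with
      | mem b h =>
        obtain ⟨m, rfl⟩ := h
        rw [powSucc_mul_powSucc]
        exact Submodule.subset_span ⟨_, rfl⟩
      | zero => rw [mul_zero]; exact zero_mem _
      | add b b' _ _ h h' => rw [mul_add]; exact add_mem h h'
      | smul c b _ h => rw [mul_smul_comm]; exact Submodule.smul_mem _ _ h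
    | zero => rw [zero_mul]; exact zero_mem _
    | add b b' _ _ h h' => rw [add_mul]; exact add_mem h h'
    | smul c b _ h => rw [smul_mul_assoc]; exact Submodule.smul_mem _ _ h
  | zero => exact zero_mem _
  | add a b ha hb => exact add_mem ha hb
  | smul c a ha => exact Submodule.smul_mem _ _ ha

/-- The powers of the generator span, and their images are distinct monomials, so a left inverse can
be written down on the monomial basis. -/
theorem toPoly_injective [Nonempty X] :
    Function.Injective (toPoly : FreeAlt k X → Polynomial k) := by
  let x : X := Classical.arbitrary X
  let s : Polynomial k →ₗ[k] FreeAlt k X :=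
    -- The truncated value at `n = 0` is harmless, since images have no constant term.
    (Polynomial.basisMonomials k).constr k fun n => powSucc (of k x) (n - 1)
  have hs (a : FreeAlt k X) : s (toPoly a) = a := by
    induction mem_span_powSucc x a using Submodule.span_induction with
    | mem a h =>
      obtain ⟨n, rfl⟩ := h
      have h := (Polynomial.basisMonomials k).constr_basis k
        (fun n => powSucc (of k x) (n - 1)) (n + 1)
      rw [Polynomial.coe_basisMonomials] at h
      rw [toPoly_powSucc, Polynomial.X_pow_eq_monomial]
      exact h
    | zero => simp
    | add a b _ _ ha hb => rw [map_add, map_add, ha, hb]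
    | smul c a _ ha => rw [map_smul, map_smul, ha]
  exact Function.LeftInverse.injective hs

/-- The hypothesis says that the polynomial of `w` composed with that of `u` is `X`. Degrees
multiply under composition, so `u` has degree one, and it has no constant term. -/
theorem eq_smul_of_lift_eq_of (x : X) {u w : FreeAlt k X} (h : lift (fun _ => u) w = of k x) :
    ∃ c : k, c ≠ 0 ∧ u = c • of k x := by
  have : Nonempty X := ⟨x⟩
  have h1 := congrArg toPoly h
  rw [toPoly_lift, toPoly_of] at h1
  have h2 := congrArg Polynomial.natDegree h1
  rw [Polynomial.natDegree_comp, Polynomial.natDegree_X] at h2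
  have h3 : (toPoly u).natDegree = 1 := Nat.eq_one_of_mul_eq_one_left h2
  have h4 : toPoly u = toPoly ((toPoly u).coeff 1 • of k x) := by
    rw [map_smul, toPoly_of, Polynomial.smul_eq_C_mul]
    conv_lhs => rw [Polynomial.eq_X_add_C_of_natDegree_le_one h3.le]
    rw [coeff_zero_toPoly, map_zero, add_zero]
  refine ⟨(toPoly u).coeff 1, fun h0 => ?_, toPoly_injective h4⟩
  rw [← h3, Polynomial.coeff_natDegree, Polynomial.leadingCoeff_eq_zero] at h0
  rw [h0] at h3
  simp at h3

end FreeAlt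

/-! ### Twisted homomorphisms -/

theorem Equiv.Perm.fin_two_eq_one_or_swap (ε : Equiv.Perm (Fin 2)) :
    ε = 1 ∨ ε = Equiv.swap 0 1 := by
  revert ε; decide

/-- The product of `a` and `b` in the order given by `ε`. -/
def permMul {A : Type*} [Mul A] (ε : Equiv.Perm (Fin 2)) (a b : A) : A :=
  ![a, b] (ε 0) * ![a, b] (ε 1)

@[simp]
theorem permMul_one {A : Type*} [Mul A] (a b : A) : permMul 1 a b = a * b := rfl

@[simp]
theorem permMul_swap {A : Type*} [Mul A] (a b : A) : permMul (Equiv.swap 0 1) a b = b * a := by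
  simp [permMul]

section

variable {k : Type u} [Field k]

/-- `σ` is additive, semilinear with respect to `φ`, and maps the product of `a` and `b` to `α`
times the product of `σ a` and `σ b` in the order given by `ε`. -/
structure IsTwist (ε : Equiv.Perm (Fin 2)) (φ : RingAut k) (α : k) {A B : Type*}
    [NonUnitalNonAssocRing A] [Module k A] [NonUnitalNonAssocRing B] [Module k B]
    (σ : A → B) : Prop where
  map_add : ∀ a b, σ (a + b) = σ a + σ b
  map_smul : ∀ (c : k) a, σ (c • a) = φ c • σ a
  map_mul : ∀ a b, σ (a * b) = α • permMul ε (σ a) (σ b)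

namespace IsTwist

variable {ε δ : Equiv.Perm (Fin 2)} {φ ψ : RingAut k} {α β : k}
variable {A : Type*} [NonUnitalNonAssocRing A] [Module k A]
variable {B : Type*} [NonUnitalNonAssocRing B] [Module k B]
variable {C : Type*} [NonUnitalNonAssocRing C] [Module k C]

theorem map_zero {σ : A → B} (h : IsTwist ε φ α σ) : σ 0 = 0 := by
  have h' := h.map_add 0 0
  rw [add_zero] at h'
  exact left_eq_add.1 h'

/-- The outer map sends the inner constant `β` to `φ β` and contributes its own `α`. -/
theorem comp {σ : B → C} {τ : A → B} (hσ : IsTwist ε φ α σ) (hτ : IsTwist δ ψ β τ) :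
    IsTwist (ε * δ) (φ * ψ) (φ β * α) (σ ∘ τ) where
  map_add a b := by simp [hσ.map_add, hτ.map_add]
  map_smul c a := by simp [hσ.map_smul, hτ.map_smul]
  map_mul a b := by
    simp only [Function.comp_apply, hτ.map_mul, hσ.map_smul, mul_smul]
    congr 1
    rcases ε.fin_two_eq_one_or_swap with rfl | rfl <;>
      rcases δ.fin_two_eq_one_or_swap with rfl | rfl <;> simp [hσ.map_mul]

theorem symm {σ : A ≃ B} (hσ : IsTwist ε φ α σ) (hα : α ≠ 0) :
    IsTwist ε φ⁻¹ (φ⁻¹ α⁻¹) σ.symm where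
  map_add a b := by rw [σ.symm_apply_eq, hσ.map_add]; simp
  map_smul c a := by
    rw [σ.symm_apply_eq, hσ.map_smul, Equiv.apply_symm_apply]
    simp
  map_mul a b := by
    rw [σ.symm_apply_eq, hσ.map_smul]
    have h (x : k) : φ (φ⁻¹ x) = x := φ.apply_symm_apply x
    rcases ε.fin_two_eq_one_or_swap with rfl | rfl <;>
      simp only [permMul_one, permMul_swap, hσ.map_mul, h, Equiv.apply_symm_apply, smul_smul,
        inv_mul_cancel₀ hα, one_smul]

/-- A twist with trivial parameters is a homomorphism. -/
def toHom {σ : A → B} (h : IsTwist 1 1 (1 : k) σ) : A →ₙₐ[k] B where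
  toFun := σ
  map_smul' := h.map_smul
  map_zero' := h.map_zero
  map_add' := h.map_add
  map_mul' a b := by rw [h.map_mul, one_smul, permMul_one]

theorem ofHom (f : A →ₙₐ[k] B) : IsTwist 1 1 (1 : k) f where
  map_add := _root_.map_add f
  map_smul := _root_.map_smul f
  map_mul a b := by rw [_root_.map_mul, one_smul, permMul_one]

/-- The parameters of `σ` and of `τ.symm` cancel, so conjugation by twists carries homomorphisms to
homomorphisms. -/
theorem conj {σ : B ≃ C} (hσ : IsTwist ε φ α σ) {D : Type*} [NonUnitalNonAssocRing D]
    [Module k D] {τ : A ≃ D} (hτ : IsTwist ε φ α τ) (hα : α ≠ 0) (f : A →ₙₐ[k] B) :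
    IsTwist 1 1 (1 : k) (σ ∘ f ∘ τ.symm) := by
  have h := hσ.comp ((ofHom f).comp (hτ.symm hα))
  have h1 : ε * (1 * ε) = 1 := by
    rcases ε.fin_two_eq_one_or_swap with rfl | rfl <;> simp
  have h2 : φ ((1 : RingAut k) (φ⁻¹ α⁻¹) * 1) * α = 1 := by
    have h (x : k) : φ (φ⁻¹ x) = x := φ.apply_symm_apply x
    rw [RingAut.one_apply, mul_one, h, inv_mul_cancel₀ hα]
  rwa [h1, one_mul, mul_inv_cancel, h2] at h

end IsTwist

/-- The algebra `A` with scalar multiplication twisted by `φ` and the multiplication replaced by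
`α` times the product in the order given by `ε`. -/
def TwistAlgebra (_ε : Equiv.Perm (Fin 2)) (_φ : RingAut k) (_α : k) (A : Type*) : Type _ := A

namespace TwistAlgebra

variable {ε : Equiv.Perm (Fin 2)} {φ : RingAut k} {α : k} {A : Type*}

/-- An element of the twisted algebra as an element of the original algebra. -/
def val (a : TwistAlgebra ε φ α A) : A := a

theorem val_injective : Function.Injective (val : TwistAlgebra ε φ α A → A) :=
  Function.injective_id

variable [NonUnitalNonAssocRing A]

instance : AddCommGroup (TwistAlgebra ε φ α A) := inferInstanceAs (AddCommGroup A)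

theorem val_zero : (0 : TwistAlgebra ε φ α A).val = 0 := rfl

theorem val_add (a b : TwistAlgebra ε φ α A) : (a + b).val = a.val + b.val := rfl

variable [Module k A]

instance : Module k (TwistAlgebra ε φ α A) where
  smul c a := (φ c • a.val : A)
  one_smul a := by
    change (φ 1 • a.val : A) = a.val
    rw [map_one, one_smul]
  mul_smul c d a := by
    change (φ (c * d) • a.val : A) = φ c • φ d • a.val
    rw [map_mul, mul_smul]
  smul_zero c := smul_zero (A := A) (φ c)
  smul_add c a b := smul_add (A := A) (φ c) a.val b.val
  add_smul c d a := by
    change (φ (c + d) • a.val : A) = φ c • a.val + φ d • a.val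
    rw [map_add, add_smul]
  zero_smul a := by
    change (φ 0 • a.val : A) = 0
    rw [map_zero, zero_smul]

instance : Mul (TwistAlgebra ε φ α A) where
  mul a b := (α • permMul ε a.val b.val : A)

theorem val_smul (c : k) (a : TwistAlgebra ε φ α A) : (c • a).val = φ c • a.val := rfl

theorem val_mul (a b : TwistAlgebra ε φ α A) : (a * b).val = α • permMul ε a.val b.val := rfl

instance : NonUnitalNonAssocRing (TwistAlgebra ε φ α A) where
  left_distrib a b c := by
    apply val_injective
    simp only [val_mul, val_add]
    rcases ε.fin_two_eq_one_or_swap with rfl | rfl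
    · simp only [permMul_one, mul_add, smul_add]
    · simp only [permMul_swap, add_mul, smul_add]
  right_distrib a b c := by
    apply val_injective
    simp only [val_mul, val_add]
    rcases ε.fin_two_eq_one_or_swap with rfl | rfl
    · simp only [permMul_one, add_mul, smul_add]
    · simp only [permMul_swap, mul_add, smul_add]
  zero_mul a := by
    apply val_injective
    rcases ε.fin_two_eq_one_or_swap with rfl | rfl <;> simp [val_mul, val_zero]
  mul_zero a := by
    apply val_injective
    rcases ε.fin_two_eq_one_or_swap with rfl | rfl <;> simp [val_mul, val_zero]

theorem isTwist_val : IsTwist ε φ α (val : TwistAlgebra ε φ α A → A) where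
  map_add _ _ := rfl
  map_smul _ _ := rfl
  map_mul _ _ := rfl

variable [IsScalarTower k A A] [SMulCommClass k A A]

instance : IsScalarTower k (TwistAlgebra ε φ α A) (TwistAlgebra ε φ α A) where
  smul_assoc c a b := by
    apply val_injective
    simp only [smul_eq_mul, val_mul, val_smul]
    rw [smul_comm (φ c) α]
    rcases ε.fin_two_eq_one_or_swap with rfl | rfl
    · simp only [permMul_one, smul_mul_assoc]
    · simp only [permMul_swap, mul_smul_comm]

instance : SMulCommClass k (TwistAlgebra ε φ α A) (TwistAlgebra ε φ α A) where
  smul_comm c a b := by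
    apply val_injective
    simp only [smul_eq_mul, val_mul, val_smul]
    rw [smul_comm (φ c) α]
    rcases ε.fin_two_eq_one_or_swap with rfl | rfl
    · simp only [permMul_one, mul_smul_comm]
    · simp only [permMul_swap, smul_mul_assoc]

/-- Reversing products exchanges the two alternative laws, and both sides of each law acquire the
same factor `α²`. -/
instance [IsAlternativeAlgebra A] : IsAlternativeAlgebra (TwistAlgebra ε φ α A) where
  left_alternative a b := by
    apply val_injective
    simp only [val_mul]
    rcases ε.fin_two_eq_one_or_swap with rfl | rfl <;>
      simp [smul_mul_assoc, mul_smul_comm, IsAlternativeAlgebra.left_alternative,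
        IsAlternativeAlgebra.right_alternative]
  right_alternative a b := by
    apply val_injective
    simp only [val_mul]
    rcases ε.fin_two_eq_one_or_swap with rfl | rfl <;>
      simp [smul_mul_assoc, mul_smul_comm, IsAlternativeAlgebra.left_alternative,
        IsAlternativeAlgebra.right_alternative]

end TwistAlgebra

namespace FreeAlt

variable {X : Type v}

/-- The homomorphism to the twisted free algebra which fixes the generators. -/
def twistHom (ε : Equiv.Perm (Fin 2)) (φ : RingAut k) (α : k) :
    FreeAlt k X →ₙₐ[k] TwistAlgebra ε φ α (FreeAlt k X) :=
  lift fun x => of k x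

/-- The twist of the free algebra which fixes the generators. -/
def twist (ε : Equiv.Perm (Fin 2)) (φ : RingAut k) (α : k) (a : FreeAlt k X) : FreeAlt k X :=
  (twistHom ε φ α a).val

variable (ε : Equiv.Perm (Fin 2)) (φ : RingAut k) {α : k}

theorem twist_of (x : X) : twist ε φ α (of k x) = of k x :=
  congrArg TwistAlgebra.val (lift_of (A := TwistAlgebra ε φ α (FreeAlt k X)) (fun x => of k x) x)

variable (α) in
theorem isTwist_twist : IsTwist ε φ α (twist ε φ α : FreeAlt k X → FreeAlt k X) := by
  have h := (TwistAlgebra.isTwist_val (ε := ε) (φ := φ) (α := α) (A := FreeAlt k X)).comp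
    (IsTwist.ofHom (twistHom ε φ α))
  rwa [mul_one, mul_one, _root_.map_one, one_mul] at h

theorem _root_.IsTwist.eq_id {σ : FreeAlt k X → FreeAlt k X} (h : IsTwist 1 1 (1 : k) σ)
    (hσ : ∀ x, σ (of k x) = of k x) (a : FreeAlt k X) : σ a = a :=
  DFunLike.congr_fun (hom_ext (g := h.toHom) (h := NonUnitalAlgHom.id k _) hσ) a

/-- The twist as a bijection. -/
def twistEquiv (hα : α ≠ 0) : FreeAlt k X ≃ FreeAlt k X where
  toFun := twist ε φ α
  invFun := twist ε⁻¹ φ⁻¹ (φ⁻¹ α⁻¹)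
  left_inv := by
    have h := (isTwist_twist (X := X) ε⁻¹ φ⁻¹ (φ⁻¹ α⁻¹)).comp (isTwist_twist (X := X) ε φ α)
    rw [inv_mul_cancel, inv_mul_cancel, ← _root_.map_mul, mul_inv_cancel₀ hα, _root_.map_one] at h
    exact h.eq_id fun x => by simp [twist_of]
  right_inv := by
    have h := (isTwist_twist (X := X) ε φ α).comp (isTwist_twist (X := X) ε⁻¹ φ⁻¹ (φ⁻¹ α⁻¹))
    have h' (x : k) : φ (φ⁻¹ x) = x := φ.apply_symm_apply x
    rw [mul_inv_cancel, mul_inv_cancel, h', inv_mul_cancel₀ hα] at h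
    exact h.eq_id fun x => by simp [twist_of]

end FreeAlt
end

/-! ### Systems of words -/

namespace FreeAlt

variable {X : Type v}

theorem one_le_weight_one (m : FreeMagma X) : 1 ≤ weight 1 m := by
  induction m with
  | ih1 x => exact le_rfl
  | ih2 x y hx hy => rw [weight_mul]; omega

theorem exists_eq_of_of_weight_one {m : FreeMagma X} (h : weight 1 m = 1) :
    ∃ x, m = FreeMagma.of x := by
  induction m with
  | ih1 x => exact ⟨x, rfl⟩
  | ih2 x y _ _ =>
    rw [weight_mul] at h
    have := one_le_weight_one x
    have := one_le_weight_one y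
    omega

theorem weight_add (v v' : X → ℕ) (m : FreeMagma X) :
    weight (v + v') m = weight v m + weight v' m := by
  induction m with
  | ih1 x => rfl
  | ih2 x y hx hy => simp only [weight_mul, hx, hy]; omega

end FreeAlt

/-! ### Words in few variables and their values. -/

namespace AltCat

variable {k : Type u}

/-- The weight counting the occurrences of the `i`-th variable. -/
def varWeight {m : ℕ} (i : Fin m) (x : (fin k m).gens) : ℕ := if x.1 = i then 1 else 0

theorem varWeight_add : varWeight 0 + varWeight 1 = (1 : (fin k 2).gens → ℕ) := by
  funext ⟨x, hx⟩
  have := Finset.mem_range.1 hx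
  interval_cases x <;> simp [varWeight]

variable [Field k]

section eval

variable {m : ℕ} {H : Type w} [NonUnitalNonAssocRing H] [Module k H] [IsScalarTower k H H]
  [SMulCommClass k H H] [IsAlternativeAlgebra H] (h : Fin m → H)

theorem eval_var (i : Fin m) : eval (var k i) h = h i := FreeAlt.lift_of _ _

theorem eval_zero : eval (0 : (fin k m).F) h = 0 := map_zero _

theorem eval_add (a b : (fin k m).F) : eval (a + b) h = eval a h + eval b h := map_add _ _ _

theorem eval_smul (c : k) (a : (fin k m).F) : eval (c • a) h = c • eval a h := map_smul _ _ _

theorem eval_mul (a b : (fin k m).F) : eval (a * b) h = eval a h * eval b h := map_mul _ _ _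

theorem eval_eq_hom (f : (fin k m).F →ₙₐ[k] H) (hf : ∀ i, f (var k i) = h i) (a : (fin k m).F) :
    eval a h = f a :=
  DFunLike.congr_fun (FreeAlt.hom_ext (g := FreeAlt.lift _) (h := f)
    fun x => (FreeAlt.lift_of _ x).trans (hf ⟨x, Finset.mem_range.1 x.2⟩).symm) a

theorem eval_var_self (a : (fin k m).F) : eval a (var k) = a :=
  eval_eq_hom _ (NonUnitalAlgHom.id k _) (fun _ => rfl) a

end eval

theorem cons_var_one : ![var k 0] = var k (m := 1) := by
  funext i; fin_cases i; rfl

theorem cons_var_two : ![var k 0, var k 1] = var k (m := 2) := by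
  funext i; fin_cases i <;> rfl

instance : Subsingleton (fin k 1).gens :=
  ⟨fun x y => Subtype.ext (by
    have := Finset.mem_range.1 x.2
    have := Finset.mem_range.1 y.2
    omega)⟩

theorem fin_two_gens_cases (x : (fin k 2).gens) :
    FreeAlt.of k x = var k 0 ∨ FreeAlt.of k x = var k 1 := by
  obtain ⟨x, hx⟩ := x
  have := Finset.mem_range.1 hx
  interval_cases x
  · exact .inl rfl
  · exact .inr rfl

theorem var_ne_zero {m : ℕ} (i : Fin m) : var k i ≠ 0 := FreeAlt.of_ne_zero _

theorem eq_zero_of_isEmpty {A : AltCat k} (hA : A.gens = ∅) (a : A.F) : a = 0 := by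
  induction a using FreeAlt.induction with
  | of x =>
    exact absurd (hA ▸ x.2 : x.1 ∈ (∅ : Finset ℕ)) (Finset.notMem_empty _)
  | mul a b ha hb => rw [ha, zero_mul]
  | zero => rfl
  | add a b ha hb => rw [ha, hb, add_zero]
  | smul c a ha => rw [ha, smul_zero]

/-- Matrix units with `en = n ≠ 0` and `ne = 0` separate the two products; evaluation at `(e, n)`
and `(n, e)` reads off the coefficients. -/
theorem smul_var_mul_var_injective {a b c d : k}
    (h : a • (var k 0 * var k 1) + b • (var k 1 * var k (m := 2) 0) =
      c • (var k 0 * var k 1) + d • (var k 1 * var k 0)) : a = c ∧ b = d := by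
  let e : Matrix (Fin 2) (Fin 2) k := !![1, 0; 0, 0]
  let n : Matrix (Fin 2) (Fin 2) k := !![0, 1; 0, 0]
  have hen : e * n = n := by ext i j; fin_cases i <;> fin_cases j <;> simp [e, n]
  have hne : n * e = 0 := by ext i j; fin_cases i <;> fin_cases j <;> simp [e, n]
  constructor
  · have h1 := congrArg (eval · ![e, n]) h
    simp [eval_add, eval_smul, eval_mul, eval_var, hen, hne] at h1
    simpa [n] using congrFun (congrFun h1 0) 1
  · have h1 := congrArg (eval · ![n, e]) h
    simp [eval_add, eval_smul, eval_mul, eval_var, hen, hne] at h1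
    simpa [n] using congrFun (congrFun h1 0) 1

theorem mem_span_of_weight_one {a : (fin k 2).F}
    (h : a ∈ Submodule.span k (FreeAlt.mon k '' {m | FreeAlt.weight 1 m = 1})) :
    ∃ c d : k, a = c • var k 0 + d • var k 1 := by
  suffices h' : a ∈ Submodule.span k {var k 0, var k 1} by
    obtain ⟨c, d, h⟩ := Submodule.mem_span_pair.1 h'
    exact ⟨c, d, h.symm⟩
  refine Submodule.span_mono ?_ h
  rintro _ ⟨m, hm, rfl⟩
  obtain ⟨x, rfl⟩ := FreeAlt.exists_eq_of_of_weight_one hm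
  exact fin_two_gens_cases x

theorem mem_span_of_varWeight_eq_one {a : (fin k 2).F}
    (h : a ∈ Submodule.span k (FreeAlt.mon k ''
      {m | FreeAlt.weight (varWeight 0) m = 1 ∧ FreeAlt.weight (varWeight 1) m = 1})) :
    ∃ c d : k, a = c • (var k 0 * var k 1) + d • (var k 1 * var k 0) := by
  suffices h' : a ∈ Submodule.span k {var k 0 * var k 1, var k 1 * var k 0} by
    obtain ⟨c, d, h⟩ := Submodule.mem_span_pair.1 h'
    exact ⟨c, d, h.symm⟩
  refine Submodule.span_mono ?_ h
  rintro _ ⟨m, ⟨h0, h1⟩, rfl⟩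
  -- The total degree is the sum of the degrees in the two variables, here two; hence the monomial
  -- is a product of two letters.
  have hw (m : FreeMagma (fin k 2).gens) : FreeAlt.weight 1 m =
      FreeAlt.weight (varWeight 0) m + FreeAlt.weight (varWeight 1) m := by
    rw [← FreeAlt.weight_add, varWeight_add]
  induction m with
  | ih1 x =>
    have h := hw (FreeMagma.of x)
    rw [h0, h1] at h
    rw [FreeAlt.weight_of] at h
    simp at h
  | ih2 a b _ _ =>
    rw [FreeAlt.weight_mul] at h0 h1
    have ha := FreeAlt.one_le_weight_one a
    have hb := FreeAlt.one_le_weight_one b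
    have ha' := hw a
    have hb' := hw b
    obtain ⟨⟨x, hx⟩, rfl⟩ := FreeAlt.exists_eq_of_of_weight_one (m := a) (by omega)
    obtain ⟨⟨y, hy⟩, rfl⟩ := FreeAlt.exists_eq_of_of_weight_one (m := b) (by omega)
    have hx' := Finset.mem_range.1 hx
    have hy' := Finset.mem_range.1 hy
    rw [map_mul, FreeAlt.mon_of, FreeAlt.mon_of]
    simp only [FreeAlt.weight_of] at h0 h1
    interval_cases x <;> interval_cases y
    · simp [varWeight] at h0
    · exact .inl rfl
    · exact .inr rfl
    · simp [varWeight] at h0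

end AltCat

namespace WordSystem

open AltCat

variable {k : Type u} [Field k]

theorem isVerbalIso_twisted_iff {ε : Equiv.Perm (Fin 2)} {φ : RingAut k} {α : k} {A : AltCat k}
    {σ : A.F ≃ A.F} : (twisted ε φ α).IsVerbalIso A σ ↔
      IsTwist ε φ α σ ∧ ∀ x : A.gens, σ (A.gen x) = A.gen x := by
  constructor
  · rintro ⟨-, h2, h3, h4, h5⟩
    refine ⟨⟨fun a b => (h3 a b).trans ?_, fun c a => (h2 c a).trans ?_,
      fun a b => (h4 a b).trans ?_⟩, h5⟩
    · simp [twisted, eval_add, eval_var]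
    · simp [twisted, eval_smul, eval_var]
    · simp [twisted, eval_smul, eval_mul, eval_var, permMul]
  · rintro ⟨h, h5⟩
    refine ⟨h.map_zero.trans ?_, fun c a => (h.map_smul c a).trans ?_,
      fun a b => (h.map_add a b).trans ?_, fun a b => (h.map_mul a b).trans ?_, h5⟩
    · simp [twisted, eval_zero]
    · simp [twisted, eval_smul, eval_var]
    · simp [twisted, eval_add, eval_var]
    · simp [twisted, eval_smul, eval_mul, eval_var, permMul]

theorem isAdmissible_twisted (ε : Equiv.Perm (Fin 2)) (φ : RingAut k) {α : k} (hα : α ≠ 0) :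
    (twisted ε φ α).IsAdmissible := fun _ =>
  ⟨FreeAlt.twistEquiv ε φ hα, isVerbalIso_twisted_iff.2
    ⟨FreeAlt.isTwist_twist ε φ α, FreeAlt.twist_of ε φ⟩⟩

theorem zero_eq_zero (W : WordSystem k) : W.zero = 0 :=
  eq_zero_of_isEmpty (A := fin k 0) rfl _

/-! ### Determination of the words of an admissible system. -/

namespace IsVerbalIso

variable {W : WordSystem k} {A : AltCat k} {σ : A.F ≃ A.F}

theorem apply_zero (h : W.IsVerbalIso A σ) : σ 0 = 0 := by
  rw [h.map_zero, zero_eq_zero, eval_zero]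

variable {σ : (fin k 1).F ≃ (fin k 1).F} {τ : (fin k 2).F ≃ (fin k 2).F}

theorem smul_eq (h : W.IsVerbalIso (fin k 1) σ) (c : k) : W.smul c = σ (c • var k 0) := by
  rw [h.map_smul, show σ (var k 0) = var k 0 from h.map_gen _, cons_var_one, eval_var_self]

theorem add_eq (h : W.IsVerbalIso (fin k 2) τ) : W.add = τ (var k 0 + var k 1) := by
  rw [h.map_add, show τ (var k 0) = var k 0 from h.map_gen _,
    show τ (var k 1) = var k 1 from h.map_gen _, cons_var_two, eval_var_self]

theorem mul_eq (h : W.IsVerbalIso (fin k 2) τ) : W.mul = τ (var k 0 * var k 1) := by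
  rw [h.map_mul, show τ (var k 0) = var k 0 from h.map_gen _,
    show τ (var k 1) = var k 1 from h.map_gen _, cons_var_two, eval_var_self]

theorem exists_smul_eq (h : W.IsVerbalIso (fin k 1) σ) (c : k) :
    ∃ d : k, W.smul c = d • var k 0 := by
  rcases eq_or_ne c 0 with rfl | hc
  · exact ⟨0, by rw [h.smul_eq, zero_smul, h.apply_zero]⟩
  -- The identity `c⁻¹(c x) = x`, transported by `σ`, makes `W.smul c` invertible under
  -- substitution.
  · have h1 : eval (W.smul c⁻¹) ![W.smul c] = var k 0 := by
      rw [h.smul_eq c, ← h.map_smul, smul_smul, inv_mul_cancel₀ hc, one_smul]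
      exact h.map_gen _
    have h2 : (fun x : Finset.range 1 =>
        ![W.smul c] ⟨x, Finset.mem_range.1 x.2⟩) = fun _ => W.smul c := by
      funext x
      rw [Matrix.cons_val_fin_one]
    rw [AltCat.eval, h2] at h1
    obtain ⟨d, -, hd⟩ := FreeAlt.eq_smul_of_lift_eq_of (X := (fin k 1).gens) _ h1
    exact ⟨d, hd⟩

theorem apply_smul {f : k → k} {σ : A.F ≃ A.F} (h : W.IsVerbalIso A σ)
    (hf : ∀ c, W.smul c = f c • var k 0) (c : k) (a : A.F) : σ (c • a) = f c • σ a := by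
  rw [h.map_smul, hf, eval_smul, eval_var]
  rfl

theorem apply_add {σ' : A.F ≃ A.F} (h : W.IsVerbalIso A σ') (hW : W.add = var k 0 + var k 1)
    (a b : A.F) :
    σ' (a + b) = σ' a + σ' b := by
  rw [h.map_add, hW, AltCat.eval_add, eval_var, eval_var]
  rfl

theorem apply_mul {σ' : A.F ≃ A.F} (h : W.IsVerbalIso A σ') {α β : k}
    (hW : W.mul = α • (var k 0 * var k 1) + β • (var k 1 * var k 0)) (a b : A.F) :
    σ' (a * b) = α • (σ' a * σ' b) + β • (σ' b * σ' a) := by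
  rw [h.map_mul, hW, AltCat.eval_add, eval_smul, eval_smul, eval_mul, eval_mul, eval_var, eval_var]
  rfl

/-- Transporting `c(x + y) = cx + cy` shows that `W.add` is homogeneous of degree one; `x + 0 = x`
and `0 + y = y` then fix its coefficients. -/
theorem add_eq_var_add_var [Infinite k] (h : W.IsVerbalIso (fin k 2) τ) {f : k → k}
    (hf : ∀ c, W.smul c = f c • var k 0) (hinj : Function.Injective f) :
    W.add = var k 0 + var k 1 := by
  have h0 : τ (var k 0) = var k 0 := h.map_gen _
  have h1 : τ (var k 1) = var k 1 := h.map_gen _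
  have hs : W.add ∈
      Submodule.span k (FreeAlt.mon k '' {m ∈ Set.univ | FreeAlt.weight 1 m = 1}) := by
    refine FreeAlt.mem_span_of_scale 1 (by rw [Set.image_univ, FreeAlt.span_mon]; trivial)
      (Set.infinite_range_of_injective hinj) ?_
    rintro _ ⟨c, rfl⟩
    have hc : FreeAlt.scale 1 (f c) W.add = AltCat.eval W.add ![f c • var k 0, f c • var k 1] := by
      refine (eval_eq_hom _ _ (fun i => ?_) _).symm
      refine (FreeAlt.scale_mon _ _ (FreeMagma.of _)).trans ?_
      rw [FreeAlt.weight_of, Pi.one_apply, pow_one]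
      fin_cases i <;> rfl
    rw [hc]
    -- As `τ` fixes the generators, each scaled argument is the image under `τ` of `c` times a
    -- generator.
    nth_rewrite 1 [← h0]
    nth_rewrite 1 [← h1]
    rw [← h.apply_smul hf, ← h.apply_smul hf, ← h.map_add, ← smul_add, h.apply_smul hf, ← h.add_eq]
  simp only [Set.mem_univ, true_and] at hs
  obtain ⟨c, d, hcd⟩ := mem_span_of_weight_one hs
  have hc := h.map_add (var k 0) 0
  rw [add_zero, h0, h.apply_zero, hcd, AltCat.eval_add, eval_smul, eval_smul, eval_var,
    eval_var] at hc
  have hd := h.map_add 0 (var k 1)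
  rw [zero_add, h1, h.apply_zero, hcd, AltCat.eval_add, eval_smul, eval_smul, eval_var,
    eval_var] at hd
  simp only [Matrix.cons_val_zero, Matrix.cons_val_one, smul_zero, add_zero, zero_add] at hc hd
  have hc' : c = 1 := FreeAlt.smul_of_injective _ (hc.symm.trans (one_smul k _).symm)
  have hd' : d = 1 := FreeAlt.smul_of_injective _ (hd.symm.trans (one_smul k _).symm)
  rw [hcd, hc', hd', one_smul, one_smul]

/-- Transporting `(cx)y = c(xy)` and `x(cy) = c(xy)` gives degree one in each variable separately.
-/
theorem exists_mul_eq [Infinite k] (h : W.IsVerbalIso (fin k 2) τ) {f : k → k}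
    (hf : ∀ c, W.smul c = f c • var k 0) (hinj : Function.Injective f) :
    ∃ α β : k, W.mul = α • (var k 0 * var k 1) + β • (var k 1 * var k 0) := by
  have h0 : τ (var k 0) = var k 0 := h.map_gen _
  have h1 : τ (var k 1) = var k 1 := h.map_gen _
  have hs0 (c : k) : FreeAlt.scale (varWeight 0) (f c) W.mul = f c • W.mul := by
    have hc : FreeAlt.scale (varWeight 0) (f c) W.mul =
        AltCat.eval W.mul ![f c • var k 0, var k 1] := by
      refine (eval_eq_hom _ _ (fun i => ?_) _).symm
      refine (FreeAlt.scale_mon _ _ (FreeMagma.of _)).trans ?_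
      rw [FreeAlt.weight_of]
      fin_cases i <;> simp [varWeight, FreeAlt.mon_of, var]
    rw [hc]
    nth_rewrite 1 [← h0]
    nth_rewrite 1 [← h1]
    rw [← h.apply_smul hf, ← h.map_mul, smul_mul_assoc, h.apply_smul hf, ← h.mul_eq]
  have hs1 (c : k) : FreeAlt.scale (varWeight 1) (f c) W.mul = f c • W.mul := by
    have hc : FreeAlt.scale (varWeight 1) (f c) W.mul =
        AltCat.eval W.mul ![var k 0, f c • var k 1] := by
      refine (eval_eq_hom _ _ (fun i => ?_) _).symm
      refine (FreeAlt.scale_mon _ _ (FreeMagma.of _)).trans ?_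
      rw [FreeAlt.weight_of]
      fin_cases i <;> simp [varWeight, FreeAlt.mon_of, var]
    rw [hc]
    nth_rewrite 1 [← h0]
    nth_rewrite 1 [← h1]
    rw [← h.apply_smul hf, ← h.map_mul, mul_smul_comm, h.apply_smul hf, ← h.mul_eq]
  have hS := Set.infinite_range_of_injective hinj
  have hu : W.mul ∈ Submodule.span k (FreeAlt.mon k '' Set.univ) := by
    rw [Set.image_univ, FreeAlt.span_mon]; trivial
  have hu' := FreeAlt.mem_span_of_scale _
    (FreeAlt.mem_span_of_scale _ hu hS (by rintro _ ⟨c, rfl⟩; exact hs0 c))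
    hS (by rintro _ ⟨c, rfl⟩; exact hs1 c)
  simp only [Set.mem_univ, true_and, Set.mem_ofPred_eq] at hu'
  exact mem_span_of_varWeight_eq_one hu'

/-- With `e² = e`, `en = n` and `ne = 0`, the transported law `(xx)y = x(xy)` at `(e, n)` reads `(α
+ β)α n = α² n`. -/
theorem mul_eq_zero_of_mul_eq (h : W.IsVerbalIso (fin k 2) τ) {α β : k}
    (hW : W.mul = α • (var k 0 * var k 1) + β • (var k 1 * var k 0)) : α * β = 0 := by
  let e : Matrix (Fin 2) (Fin 2) k := !![1, 0; 0, 0]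
  let n : Matrix (Fin 2) (Fin 2) k := !![0, 1; 0, 0]
  have hee : e * e = e := by ext i j; fin_cases i <;> fin_cases j <;> simp [e]
  have hen : e * n = n := by ext i j; fin_cases i <;> fin_cases j <;> simp [e, n]
  have hne : n * e = 0 := by ext i j; fin_cases i <;> fin_cases j <;> simp [e, n]
  have h0 : τ (var k 0) = var k 0 := h.map_gen _
  have h1 : τ (var k 1) = var k 1 := h.map_gen _
  have hm := h.apply_mul hW
  have key := congrArg (fun a => AltCat.eval (τ a) ![e, n])
    (IsAlternativeAlgebra.left_alternative (var k 0) (var k (m := 2) 1))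
  simp only [hm, h0, h1, AltCat.eval_add, eval_smul, eval_mul, eval_var, Matrix.cons_val_zero,
    Matrix.cons_val_one, smul_mul_assoc, mul_smul_comm, add_mul, mul_add, hee, hen, hne, smul_zero,
    add_zero, mul_zero, zero_mul] at key
  have key' := congrFun (congrFun key 0) 1
  simpa [n, or_comm] using key'

theorem ne_zero_of_mul_eq (h : W.IsVerbalIso (fin k 2) τ) {α β : k}
    (hW : W.mul = α • (var k 0 * var k 1) + β • (var k 1 * var k 0)) : α ≠ 0 ∨ β ≠ 0 := by
  by_contra! h0
  rw [h0.1, h0.2, zero_smul, zero_smul, add_zero, h.mul_eq, ← h.apply_zero, τ.apply_eq_iff_eq] at hW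
  have := smul_var_mul_var_injective (k := k) (a := 1) (b := 0) (c := 0) (d := 0) (by simp [hW])
  exact one_ne_zero this.1

theorem exists_ringAut (h : W.IsVerbalIso (fin k 1) σ) {f : k → k}
    (hf : ∀ c, W.smul c = f c • var k 0) (hadd : W.add = var k 0 + var k 1) {α β : k}
    (hmul : W.mul = α • (var k 0 * var k 1) + β • (var k 1 * var k 0)) :
    ∃ φ : RingAut k, ∀ c, φ c = f c := by
  have h0 : σ (var k 0) = var k 0 := h.map_gen _
  have hsm (c : k) : σ (c • var k 0) = f c • var k 0 := by rw [h.apply_smul hf, h0]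
  have hi : Function.Injective fun c : k => c • var k (0 : Fin 1) := FreeAlt.smul_of_injective _
  have f_zero : f 0 = 0 := hi <| by
    simp only [← hsm, zero_smul, h.apply_zero]
  let F : k →+* k :=
    { toFun := f
      map_one' := hi <| by simp only [← hsm, one_smul, h0]
      map_mul' := fun c d => hi <| by
        simp only [← hsm, mul_smul]
        rw [h.apply_smul hf, hsm]
      map_zero' := f_zero
      map_add' := fun c d => hi <| by
        simp only [← hsm, add_smul]
        rw [h.apply_add hadd, hsm, hsm] }
  have hF : Function.Surjective F := by
    intro d
    let x : (fin k 1).gens := ⟨0, Finset.mem_range.2 one_pos⟩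
    have hx : var k (0 : Fin 1) = FreeAlt.of k x := rfl
    -- Both products and their images have no linear part, so `σ` acts on linear coefficients
    -- through `F`; surjectivity of `F` is inherited from `σ`.
    have hℓ (a : (fin k 1).F) : FreeAlt.coord k x (σ a) = F (FreeAlt.coord k x a) := by
      induction a using FreeAlt.induction with
      | of y => rw [Subsingleton.elim y x, ← hx, h0, hx, FreeAlt.coord_of_self, _root_.map_one]
      | mul a b _ _ =>
        rw [h.apply_mul hmul, _root_.map_add, _root_.map_smul, _root_.map_smul, FreeAlt.coord_mul,
          FreeAlt.coord_mul, FreeAlt.coord_mul, smul_zero, smul_zero, add_zero, _root_.map_zero]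
      | zero => rw [h.apply_zero, _root_.map_zero, _root_.map_zero]
      | add a b ha hb =>
        rw [h.apply_add hadd, _root_.map_add, _root_.map_add, _root_.map_add, ha, hb]
      | smul c a ha =>
        rw [h.apply_smul hf, _root_.map_smul, _root_.map_smul, ha, smul_eq_mul, smul_eq_mul,
          _root_.map_mul]
        rfl
    refine ⟨FreeAlt.coord k x (σ.symm (d • var k 0)), ?_⟩
    rw [← hℓ, σ.apply_symm_apply, hx, _root_.map_smul, FreeAlt.coord_of_self, smul_eq_mul, mul_one]
  exact ⟨RingEquiv.ofBijective F ⟨F.injective, hF⟩, fun c => rfl⟩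

end IsVerbalIso

theorem IsAdmissible.exists_eq_twisted [CharZero k] {W : WordSystem k} (hW : W.IsAdmissible) :
    ∃ (ε : Equiv.Perm (Fin 2)) (φ : RingAut k) (α : k), α ≠ 0 ∧ W = twisted ε φ α := by
  have : Infinite k := CharZero.infinite k
  obtain ⟨σ, hσ⟩ := hW (fin k 1)
  obtain ⟨τ, hτ⟩ := hW (fin k 2)
  choose f hf using hσ.exists_smul_eq
  have hinj : Function.Injective f := fun c d hcd =>
    FreeAlt.smul_of_injective _ (σ.injective (by
      change σ (c • var k 0) = σ (d • var k 0)
      rw [← hσ.smul_eq, ← hσ.smul_eq, hf, hf, hcd]))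
  have hadd := hτ.add_eq_var_add_var hf hinj
  obtain ⟨α, β, hmul⟩ := hτ.exists_mul_eq hf hinj
  obtain ⟨φ, hφ⟩ := hσ.exists_ringAut hf hadd hmul
  rcases mul_eq_zero.1 (hτ.mul_eq_zero_of_mul_eq hmul) with rfl | rfl
  · refine ⟨Equiv.swap 0 1, φ, β, ?_, ?_⟩
    · simpa using hτ.ne_zero_of_mul_eq hmul
    · ext
      · exact zero_eq_zero W
      · rw [hf, ← hφ]; rfl
      · exact hadd
      · rw [hmul, zero_smul, zero_add]; rfl
  · refine ⟨1, φ, α, ?_, ?_⟩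
    · simpa using hτ.ne_zero_of_mul_eq hmul
    · ext
      · exact zero_eq_zero W
      · rw [hf, ← hφ]; rfl
      · exact hadd
      · rw [hmul, zero_smul, add_zero]; rfl

theorem isAdmissible_iff [CharZero k] (W : WordSystem k) : W.IsAdmissible ↔
    ∃ (ε : Equiv.Perm (Fin 2)) (φ : RingAut k) (α : k), α ≠ 0 ∧ W = .twisted ε φ α :=
  ⟨fun h => h.exists_eq_twisted, by
    rintro ⟨ε, φ, α, hα, rfl⟩
    exact isAdmissible_twisted ε φ hα⟩

end WordSystem

/-! ### Strongly stable automorphisms -/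

/-- An automorphism of a category which fixes all objects, from its action on morphisms. -/
def CatAut.ofHomEquiv {C : Type v} [Category.{u} C] (e : ∀ X Y : C, (X ⟶ Y) ≃ (X ⟶ Y))
    (map_id : ∀ X, e X X (𝟙 X) = 𝟙 X)
    (map_comp : ∀ {X Y Z} (f : X ⟶ Y) (g : Y ⟶ Z), e X Z (f ≫ g) = e X Y f ≫ e Y Z g) :
    CatAut C where
  hom := Functor.toCatHom
    { obj := fun X => X
      map := fun f => e _ _ f
      map_id := map_id
      map_comp := map_comp }
  inv := Functor.toCatHom
    { obj := fun X => X
      map := fun f => (e _ _).symm f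
      map_id := fun X => by rw [Equiv.symm_apply_eq]; exact (map_id X).symm
      map_comp := fun f g => by
        rw [Equiv.symm_apply_eq, map_comp, Equiv.apply_symm_apply, Equiv.apply_symm_apply] }
  hom_inv_id := Cat.ext (CategoryTheory.Functor.hext (fun _ => rfl) fun _ _ f =>
    heq_of_eq ((e _ _).symm_apply_apply f))
  inv_hom_id := Cat.ext (CategoryTheory.Functor.hext (fun _ => rfl) fun _ _ f =>
    heq_of_eq ((e _ _).apply_symm_apply f))

namespace AltCat

variable {k : Type u} [Field k]

theorem hom_ext {A B : AltCat k} {f g : A ⟶ B} (h : ∀ a, toHom f a = toHom g a) : f = g :=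
  NonUnitalAlgHom.ext h

theorem toHom_comp {A B C : AltCat k} (f : A ⟶ B) (g : B ⟶ C) (a : A.F) :
    toHom (f ≫ g) a = toHom g (toHom f a) := rfl

theorem toHom_id {A : AltCat k} (a : A.F) : toHom (𝟙 A) a = a := rfl

/-- The conjugate of a homomorphism by a system of twists. -/
def conjHom {ε : Equiv.Perm (Fin 2)} {φ : RingAut k} {α : k} (hα : α ≠ 0)
    {s : ∀ A : AltCat k, A.F ≃ A.F} (hs : ∀ A, IsTwist ε φ α (s A)) {A B : AltCat k} (f : A ⟶ B) :
    A ⟶ B :=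
  ((hs B).conj (hs A) hα (toHom f)).toHom

theorem conjHom_apply {ε : Equiv.Perm (Fin 2)} {φ : RingAut k} {α : k} (hα : α ≠ 0)
    {s : ∀ A : AltCat k, A.F ≃ A.F} (hs : ∀ A, IsTwist ε φ α (s A)) {A B : AltCat k} (f : A ⟶ B)
    (a : A.F) : toHom (conjHom hα hs f) a = s B (toHom f ((s A).symm a)) := rfl

/-- The automorphism of `Θ⁰` given by conjugation with a system of twists. -/
def conjAut {ε : Equiv.Perm (Fin 2)} {φ : RingAut k} {α : k} (hα : α ≠ 0)
    {s : ∀ A : AltCat k, A.F ≃ A.F} (hs : ∀ A, IsTwist ε φ α (s A)) : CatAut (AltCat k) :=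
  CatAut.ofHomEquiv
    (fun A B =>
      { toFun := conjHom hα hs
        invFun := conjHom ((map_ne_zero (φ⁻¹ : RingAut k)).2 (inv_ne_zero hα))
          fun A => (hs A).symm hα
        left_inv := fun f => hom_ext fun a => by simp [conjHom_apply]
        right_inv := fun f => hom_ext fun a => by simp [conjHom_apply] })
    (fun A => hom_ext fun a => (s A).apply_symm_apply a)
    (fun {A B C} f g => hom_ext fun a => by
      change s C (toHom g (toHom f ((s A).symm a))) =
        s C (toHom g ((s B).symm (s B (toHom f ((s A).symm a)))))
      rw [Equiv.symm_apply_apply])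

theorem isStronglyStableBy_conjAut {ε : Equiv.Perm (Fin 2)} {φ : RingAut k} {α : k} (hα : α ≠ 0)
    {s : ∀ A : AltCat k, A.F ≃ A.F} (hs : ∀ A, IsTwist ε φ α (s A))
    (hgen : ∀ (A : AltCat k) (x : A.gens), s A (A.gen x) = A.gen x) :
    IsStronglyStableBy (conjAut hα hs) s where
  obj_eq _ := rfl
  map_eq _ _ := rfl
  gen_eq := hgen

namespace IsStronglyStableBy

variable {Φ Ψ : CatAut (AltCat k)} {s t : ∀ A : AltCat k, A.F ≃ A.F}

/-- The action on morphisms of an automorphism which fixes the objects. -/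
def map (h : IsStronglyStableBy Φ s) {D E : AltCat k} (ψ : D ⟶ E) : D ⟶ E :=
  eqToHom (h.obj_eq D).symm ≫ Φ.functor.map ψ ≫ eqToHom (h.obj_eq E)

theorem map_apply (h : IsStronglyStableBy Φ s) {D E : AltCat k} (ψ : D ⟶ E) (a : D.F) :
    toHom (h.map ψ) a = s E (toHom ψ ((s D).symm a)) := h.map_eq ψ a

theorem functor_map_eq (h : IsStronglyStableBy Φ s) {D E : AltCat k} (ψ : D ⟶ E) :
    Φ.functor.map ψ = eqToHom (h.obj_eq D) ≫ h.map ψ ≫ eqToHom (h.obj_eq E).symm := by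
  simp [map]

theorem mul (hΦ : IsStronglyStableBy Φ s) (hΨ : IsStronglyStableBy Ψ t) :
    IsStronglyStableBy (Φ * Ψ) (fun A => (t A).trans (s A)) where
  obj_eq A := (congrArg Φ.functor.obj (hΨ.obj_eq A)).trans (hΦ.obj_eq A)
  map_eq {D E} ψ a := by
    have h : (Φ * Ψ).functor.map ψ = Φ.functor.map (Ψ.functor.map ψ) := rfl
    have h' : eqToHom ((congrArg Φ.functor.obj (hΨ.obj_eq D)).trans (hΦ.obj_eq D)).symm ≫
        Φ.functor.map (Ψ.functor.map ψ) ≫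
        eqToHom ((congrArg Φ.functor.obj (hΨ.obj_eq E)).trans (hΦ.obj_eq E)) =
        hΦ.map (hΨ.map ψ) := by
      simp [map, eqToHom_map]
    refine (congrArg (fun f : D ⟶ E => toHom f a) h').trans ?_
    rw [map_apply, map_apply]
    rfl
  gen_eq A x := by rw [Equiv.trans_apply, hΨ.gen_eq, hΦ.gen_eq]

/-- Evaluation at `a` is a morphism `f`, and its image under `Φ` is the homomorphism taking the
generators to the `s A (a i)`, because `s` fixes generators. The conjugation formula compares the
two. -/
theorem apply_eval (h : IsStronglyStableBy Φ s) {m : ℕ} {A : AltCat k} (w : (fin k m).F)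
    (a : Fin m → A.F) : s A (AltCat.eval w a) = AltCat.eval (s (fin k m) w) (s A ∘ a) := by
  let f : fin k m ⟶ A := FreeAlt.lift fun x : Finset.range m => a ⟨x, Finset.mem_range.1 x.2⟩
  have hf (w : (fin k m).F) : toHom f w = AltCat.eval w a := rfl
  have hs (i : Fin m) : (s (fin k m)).symm (var k i) = var k i :=
    (Equiv.symm_apply_eq _).2 (h.gen_eq _ _).symm
  have h1 := eval_eq_hom (s A ∘ a) (toHom (h.map f)) (fun i => by
    rw [h.map_apply, hs, hf]
    exact congrArg (s A) (eval_var a i)) (s (fin k m) w)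
  rw [h1, h.map_apply, Equiv.symm_apply_apply, hf]

end IsStronglyStableBy

end AltCat

namespace WordSystem

open AltCat

variable {k : Type u} [Field k]

/-- The system of words defined by a system of bijections. -/
def ofBij (s : ∀ A : AltCat k, A.F ≃ A.F) : WordSystem k where
  zero := s (fin k 0) 0
  smul c := s (fin k 1) (c • var k 0)
  add := s (fin k 2) (var k 0 + var k 1)
  mul := s (fin k 2) (var k 0 * var k 1)

theorem corresponds_iff {Φ : CatAut (AltCat k)} {W : WordSystem k} :
    Corresponds Φ W ↔ ∃ s, IsStronglyStableBy Φ s ∧ W = ofBij s := by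
  refine exists_congr fun s => and_congr_right fun _ => ⟨?_, ?_⟩
  · rintro ⟨h1, h2, h3, h4⟩
    exact WordSystem.ext h1 (funext h2) h3 h4
  · rintro rfl
    exact ⟨rfl, fun _ => rfl, rfl, rfl⟩

theorem isVerbalIso_ofBij {Φ : CatAut (AltCat k)} {s : ∀ A : AltCat k, A.F ≃ A.F}
    (h : IsStronglyStableBy Φ s) (A : AltCat k) : (ofBij s).IsVerbalIso A (s A) where
  map_zero := by
    have h1 := h.apply_eval (A := A) 0 ![]
    rw [AltCat.eval_zero] at h1
    rw [h1]
    exact congrArg _ (Subsingleton.elim _ _)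
  map_smul c a := by
    have h1 := h.apply_eval (c • var k 0) ![a]
    rw [AltCat.eval_smul, eval_var] at h1
    refine h1.trans (congrArg _ ?_)
    funext i; fin_cases i; rfl
  map_add a b := by
    have h1 := h.apply_eval (var k 0 + var k 1) ![a, b]
    rw [AltCat.eval_add, eval_var, eval_var] at h1
    refine h1.trans (congrArg _ ?_)
    funext i; fin_cases i <;> rfl
  map_mul a b := by
    have h1 := h.apply_eval (var k 0 * var k 1) ![a, b]
    rw [AltCat.eval_mul, eval_var, eval_var] at h1
    refine h1.trans (congrArg _ ?_)
    funext i; fin_cases i <;> rfl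
  map_gen := h.gen_eq A

theorem corresponds_twisted_iff {Φ : CatAut (AltCat k)} {ε : Equiv.Perm (Fin 2)} {φ : RingAut k}
    {α : k} : Corresponds Φ (.twisted ε φ α) ↔
      ∃ s, IsStronglyStableBy Φ s ∧ ∀ A, IsTwist ε φ α (s A) := by
  rw [corresponds_iff]
  refine exists_congr fun s => and_congr_right fun h => ⟨fun hW A => ?_, fun hs => ?_⟩
  · have h1 := isVerbalIso_ofBij h A
    rw [← hW] at h1
    exact (isVerbalIso_twisted_iff.1 h1).1
  · have hv {m : ℕ} (i : Fin m) : s (fin k m) (var k i) = var k i := h.gen_eq _ _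
    ext
    · exact ((hs _).map_zero).symm
    · exact (((hs _).map_smul _ _).trans (by rw [hv]; rfl)).symm
    · exact (((hs _).map_add _ _).trans (by rw [hv, hv]; rfl)).symm
    · refine (((hs _).map_mul _ _).trans ?_).symm
      rw [hv, hv, permMul, cons_var_two]
      rfl

theorem exists_corresponds_of_isStronglyStable [CharZero k] {Φ : CatAut (AltCat k)}
    (h : IsStronglyStable Φ) : ∃ (ε : Equiv.Perm (Fin 2)) (φ : RingAut k) (α : k), α ≠ 0 ∧
      Corresponds Φ (.twisted ε φ α) := by
  obtain ⟨s, hs⟩ := h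
  have hW : (ofBij s).IsAdmissible := fun A => ⟨s A, isVerbalIso_ofBij hs A⟩
  obtain ⟨ε, φ, α, hα, h⟩ := hW.exists_eq_twisted
  exact ⟨ε, φ, α, hα, corresponds_iff.2 ⟨s, hs, h.symm⟩⟩

theorem exists_corresponds (ε : Equiv.Perm (Fin 2)) (φ : RingAut k) {α : k} (hα : α ≠ 0) :
    ∃ Φ : CatAut (AltCat k), Corresponds Φ (.twisted ε φ α) :=
  ⟨conjAut hα (s := fun _ => FreeAlt.twistEquiv ε φ hα) fun _ => FreeAlt.isTwist_twist ε φ α,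
    corresponds_twisted_iff.2 ⟨_, isStronglyStableBy_conjAut hα _ fun _ => FreeAlt.twist_of ε φ,
      fun _ => FreeAlt.isTwist_twist ε φ α⟩⟩

theorem Corresponds.mul {Φ Ψ : CatAut (AltCat k)} {ε δ : Equiv.Perm (Fin 2)} {φ ψ : RingAut k}
    {α β : k} (hΦ : Corresponds Φ (.twisted ε φ α)) (hΨ : Corresponds Ψ (.twisted δ ψ β)) :
    Corresponds (Φ * Ψ) (.twisted (ε * δ) (φ * ψ) (φ β * α)) := by
  rw [corresponds_twisted_iff] at *
  obtain ⟨s, hs, hs'⟩ := hΦ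
  obtain ⟨t, ht, ht'⟩ := hΨ
  exact ⟨_, hs.mul ht, fun A => (hs' A).comp (ht' A)⟩

end WordSystem

/-! ### Inner automorphisms -/

namespace AltCat

variable {k : Type u} [Field k]

variable (k) in
/-- The generator of the free algebra with one generator. -/
abbrev gen₁ : (fin k 1).gens := ⟨0, Finset.mem_range.2 one_pos⟩

/-- The homomorphism from the free algebra with one generator which maps the generator to `a`. -/
def point {A : AltCat k} (a : A.F) : fin k 1 ⟶ A := FreeAlt.lift fun _ => a

theorem point_var {A : AltCat k} (a : A.F) : toHom (point a) (var k 0) = a := FreeAlt.lift_of _ _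

theorem point_smul_var {A : AltCat k} (a : A.F) (c : k) :
    toHom (point a) (c • var k 0) = c • a := by
  rw [map_smul, point_var]

theorem hom_ext_fin_one {A : AltCat k} {f g : fin k 1 ⟶ A}
    (h : toHom f (var k 0) = toHom g (var k 0)) : f = g :=
  FreeAlt.hom_ext fun x => by
    rw [Subsingleton.elim x ⟨0, Finset.mem_range.2 one_pos⟩]; exact h

theorem point_comp {A B : AltCat k} (a : A.F) (f : A ⟶ B) : point a ≫ f = point (toHom f a) :=
  hom_ext_fin_one (by rw [toHom_comp, point_var, point_var])

/-- A bijective homomorphism is an isomorphism. -/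
def isoOfIsTwist {A B : AltCat k} (σ : A.F ≃ B.F) (h : IsTwist 1 1 (1 : k) σ) : A ≅ B where
  hom := h.toHom
  inv := IsTwist.toHom (σ := σ.symm) (by
    have h' := h.symm one_ne_zero
    rwa [inv_one, inv_one, map_one] at h')
  hom_inv_id := hom_ext σ.symm_apply_apply
  inv_hom_id := hom_ext σ.apply_symm_apply

/-- A system of bijections which commutes with all homomorphisms consists of the multiplications by
a scalar. -/
theorem exists_smul_of_natural (d : ∀ A : AltCat k, A.F ≃ A.F)
    (hd : ∀ {A B : AltCat k} (f : A ⟶ B) (a : A.F), d B (toHom f a) = toHom f (d A a)) :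
    ∃ c : k, c ≠ 0 ∧ ∀ (A : AltCat k) (a : A.F), d A a = c • a := by
  let x : (fin k 1).F := var k 0
  -- Naturality along the morphism `x ↦ a` determines `d` by the single word `d x`; the same
  -- argument at `d⁻¹ x` shows that this word is invertible under substitution.
  have hd' {A : AltCat k} (a : A.F) : d A a = toHom (point a) (d _ x) := by
    rw [← hd, point_var]
  have h : toHom (point (d _ x)) ((d _).symm x) = x := by
    rw [← (d _).apply_eq_iff_eq, hd, Equiv.apply_symm_apply, point_var]
  obtain ⟨c, hc, hx⟩ := FreeAlt.eq_smul_of_lift_eq_of (X := (fin k 1).gens) _ h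
  exact ⟨c, hc, fun A a => by rw [hd', hx]; exact point_smul_var a c⟩

namespace IsStronglyStableBy

variable {Φ : CatAut (AltCat k)} {s : ∀ A : AltCat k, A.F ≃ A.F}

/-- A natural isomorphism `τ` and the system `s` implement the same action on morphisms, so `s⁻¹τ`
commutes with all of them and is a scalar `c`. The map in the conclusion is then the homomorphism
`τ`. -/
theorem exists_of_mem_innerAut (h : IsStronglyStableBy Φ s) (hΦ : Φ ∈ innerAut (AltCat k)) :
    ∃ c : k, c ≠ 0 ∧ ∀ A, IsTwist 1 1 (1 : k) fun a : A.F => s A (c • a) := by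
  obtain ⟨η⟩ := hΦ
  let τ (A : AltCat k) : A ≅ A := η.app A ≪≫ eqToIso (h.obj_eq A)
  have hτ {D E : AltCat k} (ψ : D ⟶ E) : ψ ≫ (τ E).hom = (τ D).hom ≫ h.map ψ := by
    have := η.hom.naturality ψ
    simp only [Functor.id_map] at this
    simp [τ, map, reassoc_of% this]
  let τ' (A : AltCat k) : A.F ≃ A.F :=
    { toFun := toHom (τ A).hom
      invFun := toHom (τ A).inv
      left_inv := fun a => by rw [← toHom_comp, Iso.hom_inv_id, toHom_id]
      right_inv := fun a => by rw [← toHom_comp, Iso.inv_hom_id, toHom_id] }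
  obtain ⟨c, hc, hd⟩ := exists_smul_of_natural
      (fun A => (τ' A).trans (s A).symm) fun {A B} f a => by
    have := congrArg (fun g => toHom g a) (hτ f)
    simp only [toHom_comp, map_apply] at this
    simp only [Equiv.trans_apply]
    rw [Equiv.symm_apply_eq]
    exact this
  refine ⟨c, hc, fun A => ?_⟩
  have : (fun a : A.F => s A (c • a)) = toHom (τ A).hom := by
    funext a
    rw [← hd, Equiv.trans_apply, Equiv.apply_symm_apply]
    rfl
  rw [this]
  exact IsTwist.ofHom _

/-- Rescaling absorbs the constant: `α s(ab) = (α s(a))(α s(b))`. Scalars commute with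
homomorphisms, so `αs` implements the same action as `s`. -/
theorem mem_innerAut (h : IsStronglyStableBy Φ s) {α : k} (hα : α ≠ 0)
    (hs : ∀ A, IsTwist 1 1 α (s A)) : Φ ∈ innerAut (AltCat k) := by
  let τ (A : AltCat k) : A.F ≃ A.F := (s A).trans (MulAction.toPerm (Units.mk0 α hα))
  have hτ (A : AltCat k) (a : A.F) : τ A a = α • s A a := rfl
  have hτ' (A : AltCat k) : IsTwist 1 1 (1 : k) (τ A) :=
    { map_add := fun a b => by simp only [hτ, (hs A).map_add, smul_add]
      map_smul := fun c a => by simp only [hτ, (hs A).map_smul, RingAut.one_apply, smul_comm c]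
      map_mul := fun a b => by
        simp only [hτ, (hs A).map_mul, permMul_one, one_smul, smul_mul_smul_comm, mul_smul] }
  refine ⟨NatIso.ofComponents
    (fun A => isoOfIsTwist (τ A) (hτ' A) ≪≫ eqToIso (h.obj_eq A).symm) fun {D E} ψ => ?_⟩
  have h1 : ψ ≫ (isoOfIsTwist (τ E) (hτ' E)).hom =
      (isoOfIsTwist (τ D) (hτ' D)).hom ≫ h.map ψ := hom_ext fun a => by
    rw [toHom_comp, toHom_comp, map_apply]
    change τ E (toHom ψ a) = s E (toHom ψ ((s D).symm (τ D a)))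
    have h2 : (s D).symm (τ D a) = α • a := by
      rw [Equiv.symm_apply_eq, hτ, (hs D).map_smul, RingAut.one_apply]
    rw [h2, map_smul, (hs E).map_smul, hτ, RingAut.one_apply]
  rw [h.functor_map_eq]
  simp [reassoc_of% h1]

end IsStronglyStableBy

end AltCat

namespace WordSystem

open AltCat

variable {k : Type u} [Field k]

namespace Corresponds

variable {Φ Ψ : CatAut (AltCat k)} {ε : Equiv.Perm (Fin 2)} {φ : RingAut k} {α β : k}

theorem mem_innerAut_iff (h : Corresponds Φ (.twisted ε φ α)) (hα : α ≠ 0) :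
    Φ ∈ innerAut (AltCat k) ↔ ε = 1 ∧ φ = 1 := by
  obtain ⟨s, hs, hs'⟩ := corresponds_twisted_iff.1 h
  constructor
  · intro hΦ
    obtain ⟨c, hc, hτ⟩ := hs.exists_of_mem_innerAut hΦ
    have hc' : φ c ≠ 0 := (map_ne_zero φ).2 hc
    have hv {m : ℕ} (i : Fin m) : s (fin k m) (var k i) = var k i := hs.gen_eq _ _
    constructor
    · rcases ε.fin_two_eq_one_or_swap with rfl | rfl
      · rfl
      -- For the transposition this reads `φ(c)α x₂x₁ = φ(c)² x₁x₂`, which is impossible.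
      · have h1 := (hτ (fin k 2)).map_mul (var k 0) (var k 1)
        simp only [(hs' _).map_smul, (hs' _).map_mul, hv, permMul_swap, permMul_one, one_mul,
          smul_mul_smul_comm, smul_smul] at h1
        have h2 := smul_var_mul_var_injective (a := 0) (b := φ c * α) (c := φ c * φ c) (d := 0)
          (by rw [zero_smul, zero_smul, zero_add, add_zero]; exact h1)
        exact absurd h2.1.symm (mul_ne_zero hc' hc')
    · ext d
      have h1 := (hτ (fin k 1)).map_smul d (var k 0)
      simp only [(hs' _).map_smul, hv, smul_smul, RingAut.one_apply, map_mul] at h1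
      have h2 := FreeAlt.smul_of_injective _ h1
      exact mul_left_cancel₀ hc' (h2.trans (mul_comm _ _))
  · rintro ⟨rfl, rfl⟩
    exact hs.mem_innerAut hα hs'

/-- An automorphism with the inverse parameters has an inner product with each of the two, so both
classes have the same inverse. -/
theorem mk_eq_mk (hα : α ≠ 0) (hβ : β ≠ 0) (hΦ : Corresponds Φ (.twisted ε φ α))
    (hΨ : Corresponds Ψ (.twisted ε φ β)) :
    (QuotientGroup.mk Φ : CatAut (AltCat k) ⧸ innerAut (AltCat k)) = QuotientGroup.mk Ψ := by
  obtain ⟨Ψ', hΨ'⟩ := exists_corresponds ε⁻¹ φ⁻¹ (one_ne_zero (α := k))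
  have h (Φ : CatAut (AltCat k)) {α : k} (hα : α ≠ 0) (hΦ : Corresponds Φ (.twisted ε φ α)) :
      (QuotientGroup.mk Ψ' : CatAut (AltCat k) ⧸ innerAut (AltCat k)) * QuotientGroup.mk Φ = 1 :=
    (QuotientGroup.eq_one_iff _).2 <| ((hΨ'.mul hΦ).mem_innerAut_iff
      (by rw [mul_one]; exact (map_ne_zero (φ⁻¹ : RingAut k)).2 hα)).2
      ⟨inv_mul_cancel ε, inv_mul_cancel φ⟩
  exact mul_left_cancel ((h Φ hα hΦ).trans (h Ψ hβ hΨ).symm)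

end Corresponds

end WordSystem

/-! ### Every automorphism is strongly stable up to inner automorphisms -/

theorem CatAut.mk_eq_mk_of_iso {C : Type v} [Category.{u} C] {Φ Ψ : CatAut C}
    (i : Φ.functor ≅ Ψ.functor) :
    (QuotientGroup.mk Φ : CatAut C ⧸ innerAut C) = QuotientGroup.mk Ψ := by
  rw [QuotientGroup.eq]
  have h : Φ.functor ⋙ Φ⁻¹.functor = 𝟭 C :=
    congrArg Cat.Hom.toFunctor (Iso.hom_inv_id (Φ : Cat.of C ≅ Cat.of C))
  exact ⟨eqToIso h.symm ≪≫ Functor.isoWhiskerRight i Φ⁻¹.functor⟩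

namespace AltCat

variable {k : Type u} [Field k]

/-- Homomorphisms from the free algebra with one generator as elements. -/
def pointEquiv (A : AltCat k) : A.F ≃ (fin k 1 ⟶ A) where
  toFun := point
  invFun f := toHom f (var k 0)
  left_inv := point_var
  right_inv _ := hom_ext_fin_one (point_var _)

theorem hom_ext_point {A B : AltCat k} {f g : A ⟶ B}
    (h : ∀ x : A.gens, point (A.gen x) ≫ f = point (A.gen x) ≫ g) : f = g :=
  FreeAlt.hom_ext fun x => by
    have h1 := congrArg (fun f => toHom f (var k 0)) (h x)
    simpa only [toHom_comp, point_var] using h1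

theorem exists_point_comp_eq {A B : AltCat k} (r : A.gens → (fin k 1 ⟶ B)) :
    ∃ g : A ⟶ B, ∀ x, point (A.gen x) ≫ g = r x :=
  ⟨FreeAlt.lift fun x => toHom (r x) (var k 0), fun x => hom_ext_fin_one <| by
    rw [toHom_comp, point_var]
    exact FreeAlt.lift_of _ x⟩

theorem point_var_zero : point (var k 0) = 𝟙 (fin k 1) := hom_ext_fin_one (point_var _)

theorem not_subsingleton_end_fin_one : ¬ Subsingleton (fin k 1 ⟶ fin k 1) := fun h => by
  have h1 := congrArg (fun f => toHom f (var k 0)) (h.elim (point 0) (point (var k 0)))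
  simp only [point_var] at h1
  exact var_ne_zero 0 h1.symm

theorem nonempty_gens {A : AltCat k} (h : ¬ Subsingleton (A ⟶ A)) : Nonempty A.gens := by
  by_contra h0
  rw [not_nonempty_iff] at h0
  exact h ⟨fun f g => FreeAlt.hom_ext fun x => h0.elim x⟩

theorem coord_hom_fin_one {A : AltCat k} (f : fin k 1 ⟶ A) (y : A.gens) (a : (fin k 1).F) :
    FreeAlt.coord k y (toHom f a) =
      FreeAlt.coord k (gen₁ k) a * FreeAlt.coord k y (toHom f (var k 0)) := by
  induction a using FreeAlt.induction with
  | of x =>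
    rw [Subsingleton.elim x (gen₁ k), FreeAlt.coord_of_self, one_mul]
    rfl
  | mul a b _ _ => rw [map_mul, FreeAlt.coord_mul, FreeAlt.coord_mul, zero_mul]
  | zero => simp only [map_zero, zero_mul]
  | add a b ha hb => simp only [map_add, ha, hb, add_mul]
  | smul c a ha => simp only [map_smul, ha, smul_eq_mul, mul_assoc]

/-- Modulo products, the identity of `A` factors through a one-dimensional space, which leaves no
room for two generators. -/
theorem subsingleton_gens_of_retract {A : AltCat k} (i : A ⟶ fin k 1) (r : fin k 1 ⟶ A)
    (h : i ≫ r = 𝟙 A) : Subsingleton A.gens := by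
  refine ⟨fun y z => by_contra fun hyz => ?_⟩
  have hr (y : A.gens) : toHom r (toHom i (A.gen y)) = A.gen y := by
    rw [← toHom_comp, h, toHom_id]
  have h1 := coord_hom_fin_one r y (toHom i (A.gen y))
  have h2 := coord_hom_fin_one r z (toHom i (A.gen y))
  have h3 := coord_hom_fin_one r z (toHom i (A.gen z))
  rw [hr, FreeAlt.coord_of_self] at h1 h3
  rw [hr, FreeAlt.coord_of_ne hyz] at h2
  rcases mul_eq_zero.1 h2.symm with h4 | h4
  · exact one_ne_zero (h1.trans (by rw [h4, zero_mul]))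
  · exact one_ne_zero (h3.trans (by rw [h4, mul_zero]))

/-- Two free algebras with one generator are isomorphic. -/
theorem nonempty_iso_fin_one {A : AltCat k} [Subsingleton A.gens] (y : A.gens) :
    Nonempty (fin k 1 ≅ A) := by
  obtain ⟨g, hg⟩ := exists_point_comp_eq fun _ : A.gens => 𝟙 (fin k 1)
  refine ⟨⟨point (A.gen y), g, hg y, hom_ext_point fun x => ?_⟩⟩
  rw [Subsingleton.elim x y, reassoc_of% hg y, Category.comp_id]

/-! ### Self-equivalences of `Θ⁰`. -/

section Equivalence

variable (F : AltCat k ⥤ AltCat k) [F.IsEquivalence]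

/-- An object with more than one endomorphism has a generator, so the one-generated algebra is a
retract of its own preimage. Applying `F` makes its image a retract of it, hence generated by
exactly one letter. -/
theorem nonempty_iso_obj_fin_one : Nonempty (fin k 1 ≅ F.obj (fin k 1)) := by
  have h1 : Nonempty (F.obj (fin k 1)).gens := nonempty_gens fun h =>
    not_subsingleton_end_fin_one (k := k) ⟨fun f g => F.map_injective (h.elim _ _)⟩
  let ι := F.objObjPreimageIso (fin k 1)
  have h2 : Nonempty (F.objPreimage (fin k 1)).gens := nonempty_gens fun h =>
    not_subsingleton_end_fin_one (k := k) ⟨fun f g => by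
      have := congrArg F.map
        (h.elim (F.preimage (ι.hom ≫ f ≫ ι.inv)) (F.preimage (ι.hom ≫ g ≫ ι.inv)))
      simpa using this⟩
  obtain ⟨z⟩ := h2
  obtain ⟨y⟩ := h1
  obtain ⟨g, hg⟩ := exists_point_comp_eq fun _ : (F.objPreimage (fin k 1)).gens => 𝟙 (fin k 1)
  have : Subsingleton (F.obj (fin k 1)).gens :=
    subsingleton_gens_of_retract (F.map (point (gen _ z)) ≫ ι.hom) (ι.inv ≫ F.map g) (by
      rw [Category.assoc, ι.hom_inv_id_assoc, ← F.map_comp, hg, F.map_id])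
  exact nonempty_iso_fin_one y

/-- The generators exhibit `A` as a copower of the one-generated algebra, and an equivalence
preserves copowers. -/
theorem exists_iso_obj (θ : fin k 1 ≅ F.obj (fin k 1)) (A : AltCat k) :
    ∃ p : A ≅ F.obj A, ∀ x : A.gens,
      point (A.gen x) ≫ p.hom = θ.hom ≫ F.map (point (A.gen x)) := by
  obtain ⟨p, hp⟩ := exists_point_comp_eq fun x : A.gens => θ.hom ≫ F.map (point (A.gen x))
  let ι := F.objObjPreimageIso A
  obtain ⟨q, hq⟩ := exists_point_comp_eq fun x : A.gens =>
    F.preimage (θ.inv ≫ point (A.gen x) ≫ ι.inv)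
  have hpq : p ≫ F.map q ≫ ι.hom = 𝟙 A := hom_ext_point fun x => by
    rw [reassoc_of% hp, ← F.map_comp_assoc, hq]
    simp
  refine ⟨⟨p, F.map q ≫ ι.hom, hpq, ?_⟩, hp⟩
  -- Fullness turns the other composite into an endomorphism of `A`, which can be tested on
  -- generators.
  obtain ⟨g, hg⟩ := F.map_surjective ((F.map q ≫ ι.hom) ≫ p)
  rw [← hg, ← F.map_id]
  congr 1
  refine hom_ext_point fun x => F.map_injective ?_
  have hx : F.map (point (A.gen x)) = θ.inv ≫ point (A.gen x) ≫ p := by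
    rw [hp, θ.inv_hom_id_assoc]
  rw [F.map_comp, hg, hx, Category.comp_id, hx]
  simp only [Category.assoc] at hpq ⊢
  rw [reassoc_of% hpq]

/-- Conjugating `F` by the isomorphisms `p` gives an automorphism fixing objects. Its action on
morphisms out of the one-generated algebra, read as elements, supplies the bijections `s`. -/
theorem exists_isStronglyStable_iso :
    ∃ Ψ : CatAut (AltCat k), IsStronglyStable Ψ ∧ Nonempty (F ≅ Ψ.functor) := by
  obtain ⟨θ⟩ := nonempty_iso_obj_fin_one F
  choose p hp using exists_iso_obj F θ
  -- The generator of the one-generated algebra corresponds to the identity morphism; this agreement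
  -- with `θ` is what makes `s` fix generators.
  have hp₁ : (p (fin k 1)).hom = θ.hom := by
    have h := hp (fin k 1) (gen₁ k)
    rwa [show point ((fin k 1).gen (gen₁ k)) = 𝟙 _ from point_var_zero, F.map_id,
      Category.id_comp, Category.comp_id] at h
  let e (A B : AltCat k) : (A ⟶ B) ≃ (A ⟶ B) :=
    { toFun := fun f => (p A).hom ≫ F.map f ≫ (p B).inv
      invFun := fun g => F.preimage ((p A).inv ≫ g ≫ (p B).hom)
      left_inv := fun f => by simp
      right_inv := fun g => by simp }
  have e_apply {A B : AltCat k} (f : A ⟶ B) : e A B f = (p A).hom ≫ F.map f ≫ (p B).inv := rfl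
  have e_comp {A B C : AltCat k} (f : A ⟶ B) (g : B ⟶ C) : e A C (f ≫ g) = e A B f ≫ e B C g := by
    simp [e_apply]
  let Ψ : CatAut (AltCat k) := CatAut.ofHomEquiv e (fun A => by simp [e_apply]) e_comp
  let s (A : AltCat k) : A.F ≃ A.F :=
    (pointEquiv A).trans ((e (fin k 1) A).trans (pointEquiv A).symm)
  have hs {A : AltCat k} (a : A.F) : s A a = toHom (e _ _ (point a)) (var k 0) := rfl
  refine ⟨Ψ, ⟨s, fun _ => rfl, fun {D E} ψ a => ?_, fun A x => ?_⟩,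
    ⟨NatIso.ofComponents (fun A => (p A).symm) fun {A B} f => ?_⟩⟩
  · obtain ⟨b, rfl⟩ := (s D).surjective a
    rw [Equiv.symm_apply_apply]
    change toHom (e D E ψ) (s D b) = s E (toHom ψ b)
    rw [hs, hs, ← point_comp, e_comp, toHom_comp]
  · rw [hs, e_apply, hp₁, ← reassoc_of% hp, Iso.hom_inv_id, Category.comp_id, point_var]
  · change F.map f ≫ (p B).inv = (p A).inv ≫ e A B f
    rw [e_apply, Iso.inv_hom_id_assoc]

end Equivalence

theorem exists_isStronglyStable_mk_eq (Φ : CatAut (AltCat k)) :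
    ∃ Ψ : CatAut (AltCat k), IsStronglyStable Ψ ∧
      (QuotientGroup.mk Ψ : CatAut (AltCat k) ⧸ innerAut (AltCat k)) = QuotientGroup.mk Φ := by
  have : Φ.functor.IsEquivalence := (Cat.equivOfIso Φ).isEquivalence_functor
  obtain ⟨Ψ, hΨ, ⟨i⟩⟩ := exists_isStronglyStable_iso Φ.functor
  exact ⟨Ψ, hΨ, (CatAut.mk_eq_mk_of_iso i).symm⟩

end AltCat

namespace WordSystem

variable {k : Type u} [Field k]

variable (k) in
/-- The homomorphism which maps `(ε, φ)` to the class of the automorphisms corresponding to the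
system of words given by `ε` and `φ`. -/
def twistedClass :
    Equiv.Perm (Fin 2) × RingAut k →* CatAut (AltCat k) ⧸ innerAut (AltCat k) :=
  MonoidHom.mk' (fun t =>
      QuotientGroup.mk (exists_corresponds t.1 t.2 (one_ne_zero (α := k))).choose)
    fun t t' => by
      rw [← QuotientGroup.mk_mul]
      exact Corresponds.mk_eq_mk one_ne_zero (by rw [map_one, one_mul]; exact one_ne_zero)
        (exists_corresponds (t * t').1 (t * t').2 one_ne_zero).choose_spec
        ((exists_corresponds t.1 t.2 one_ne_zero).choose_spec.mul
          (exists_corresponds t'.1 t'.2 one_ne_zero).choose_spec)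

theorem Corresponds.twistedClass_eq {Φ : CatAut (AltCat k)} {ε : Equiv.Perm (Fin 2)}
    {φ : RingAut k} {α : k} (h : Corresponds Φ (.twisted ε φ α)) (hα : α ≠ 0) :
    twistedClass k (ε, φ) = QuotientGroup.mk Φ :=
  Corresponds.mk_eq_mk one_ne_zero hα (exists_corresponds ε φ one_ne_zero).choose_spec h

theorem twistedClass_bijective [CharZero k] : Function.Bijective (twistedClass k) := by
  constructor
  · rw [injective_iff_map_eq_one]
    rintro ⟨ε, φ⟩ h
    obtain ⟨Φ, hΦ⟩ := exists_corresponds ε φ (one_ne_zero (α := k))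
    rw [hΦ.twistedClass_eq one_ne_zero, QuotientGroup.eq_one_iff,
      hΦ.mem_innerAut_iff one_ne_zero] at h
    rw [h.1, h.2]
    rfl
  · intro q
    obtain ⟨Φ, rfl⟩ := QuotientGroup.mk_surjective q
    obtain ⟨Ψ, hΨ, h⟩ := AltCat.exists_isStronglyStable_mk_eq Φ
    obtain ⟨ε, φ, α, hα, hW⟩ := exists_corresponds_of_isStronglyStable hΨ
    exact ⟨(ε, φ), (hW.twistedClass_eq hα).trans h⟩

end WordSystem
end

theorem mainTheorem2 (k : Type u) [Field k] [CharZero k] :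
    -- The possible systems of words.
    (∀ W : WordSystem k, W.IsAdmissible ↔
      ∃ (ε : Equiv.Perm (Fin 2)) (φ : RingAut k) (α : k), α ≠ 0 ∧ W = .twisted ε φ α) ∧
    -- Each strongly stable automorphism corresponds to one of them, and each of them occurs.
    (∀ Φ : CatAut (AltCat k), AltCat.IsStronglyStable Φ →
      ∃ (ε : Equiv.Perm (Fin 2)) (φ : RingAut k) (α : k), α ≠ 0 ∧
        WordSystem.Corresponds Φ (.twisted ε φ α)) ∧
    (∀ (ε : Equiv.Perm (Fin 2)) (φ : RingAut k) (α : k), α ≠ 0 →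
      ∃ Φ : CatAut (AltCat k), WordSystem.Corresponds Φ (.twisted ε φ α)) ∧
    -- The quotient group.
    ∃ e : CatAut (AltCat k) ⧸ innerAut (AltCat k) ≃* Equiv.Perm (Fin 2) × RingAut k,
      ∀ (Φ : CatAut (AltCat k)) (ε : Equiv.Perm (Fin 2)) (φ : RingAut k) (α : k), α ≠ 0 →
        WordSystem.Corresponds Φ (.twisted ε φ α) → e (QuotientGroup.mk Φ) = (ε, φ) := by
  refine ⟨WordSystem.isAdmissible_iff,
    fun _ => WordSystem.exists_corresponds_of_isStronglyStable,
    fun ε φ _ => WordSystem.exists_corresponds ε φ,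
    (MulEquiv.ofBijective _ WordSystem.twistedClass_bijective).symm, fun Φ ε φ α hα h => ?_⟩
  rw [MulEquiv.symm_apply_eq]
  exact (h.twistedClass_eq hα).symm
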